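/- **Model.** Consider pairs $(Tx_n,Rx_n)$, $n\in\mathbb N$, in the plane. The locations $T_n$ of $Tx_n$ form a homogeneous Poisson point process (PPP) of intensity $\lambda_0>0$. The location $R_n$ of $Rx_n$ is at a fixed distance $d>0$ from $T_n$, in a uniformly distributed direction. Each pair is active with probability $P_a\in(0,1]$, so that the density of active pairs is $\lambda=P_a\lambda_0$. The channel $h_{mn}$ from $Tx_n$ to $Rx_m$ and the channel $g_{mn}$ from $Rx_n$ to $Tx_m$ are circularly symmetric complex Gaussian $\mathcal{CN}(0,1)$. The process of locations, the directions, the activity indicators and all the channels are independent. Let $\alpha>2$ be the path-loss exponent. The two directions use disjoint frequency bands (frequency division duplex) of widths $F_{TR}>0$ and $F_{RT}=F_{total}-F_{TR}>0$, and noise is neglected. The signal-to-interference ratios of an active pair $m$ are $$SIR_{TR}=\frac{d^{-\alpha}|h_{mm}|^2}{\sum_{n\ne m,\ n\text{ active}}|T_n-R_m|^{-\alpha}|h_{mn}|^2},\qquad SIR_{RT}=\frac{d^{-\alpha}|g_{mm}|^2}{\sum_{n\ne m,\ n\text{ active}}|R_n-T_m|^{-\alpha}|g_{mn}|^2}.$$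 Given rate demands $B_{TR},B_{RT}>0$, the pair $m$ is successful if $$F_{TR}\log_2(1+SIR_{TR})>B_{TR}\quad\text{and}\quad F_{RT}\log_2(1+SIR_{RT})>B_{RT}.$$ Let $P_{success}(\lambda)$ be the success probability of a typical active pair (its Palm probability: the expected number of successful active pairs with transmitter in a unit square, divided by the expected number of active pairs with transmitter in that square). For $\epsilon\in(0,1)$ let $\lambda_\epsilon$ be the largest density $\lambda>0$ with $P_{success}(\lambda)\ge 1-\epsilon$. The two-way transmission capacity is $$C_\epsilon:=(1-\epsilon)\,\lambda_\epsilon\,\frac{B_{TR}+B_{RT}}{F_{total}}.$$ **Theorem.** Put $\beta_1=d^\alpha(2^{B_{TR}/F_{TR}}-1)$, $\beta_2=d^\alpha(2^{B_{RT}/F_{RT}}-1)$, and $$c_1=\frac{2\pi^2\csc(2\pi/\alpha)}{\alpha},\qquad c_2=\frac{\pi^2\csc(2\pi/\alpha)\,(\alpha+2)}{\alpha^2}.$$ Then the maximal density $\lambda_\epsilon$ exists, $P_{success}(\lambda_\epsilon)=1-\epsilon$, and $$\frac{-(1-\epsilon)\ln(1-\epsilon)}{c_1\,(\beta_1^{2/\alpha}+\beta_2^{2/\alpha})}\cdot\frac{B_{TR}+B_{RT}}{F_{total}}\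 \le\ C_\epsilon\ \le\ \frac{-(1-\epsilon)\ln(1-\epsilon)}{c_2\,(\beta_1^{2/\alpha}+\beta_2^{2/\alpha})}\cdot\frac{B_{TR}+B_{RT}}{F_{total}},$$ and $c_2/c_1=\frac12+\frac1\alpha$. -/

import Mathlib

open MeasureTheory ProbabilityTheory
open scoped ENNReal

noncomputable section

namespace TwoWay

/-- The Euclidean plane, with Lebesgue measure `volume`. -/
abbrev Plane : Type := EuclideanSpace ℝ (Fin 2)

/-- The random points `T 0, T 1, …` form (as a multiset) a homogeneous Poisson point process of
intensity `lam` on the plane: the numbers of points in disjoint Borel sets of finite area are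
independent Poisson variables whose means are `lam` times the areas. -/
def IsHomogeneousPPP {Ω : Type*} [MeasurableSpace Ω] (P : Measure Ω) (lam : ℝ)
    (T : ℕ → Ω → Plane) : Prop :=
  (∀ n, Measurable (T n)) ∧
  ∀ (r : ℕ) (B : Fin r → Set Plane) (k : Fin r → ℕ),
    (∀ i, MeasurableSet (B i)) → (∀ i, volume (B i) < ∞) →
    Pairwise (Function.onFun Disjoint B) →
    P.real {ω | ∀ i, {n | T n ω ∈ B i}.encard = k i} =
      ∏ i, Real.exp (-(lam * volume.real (B i))) * (lam * volume.real (B i)) ^ k i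
        / (k i).factorial

/-- The circularly symmetric complex Gaussian law `CN(0,1)`: real and imaginary parts are
independent centred Gaussians of variance `1/2`. -/
def complexGaussian : Measure ℂ :=
  ((gaussianReal 0 (1 / 2)).prod (gaussianReal 0 (1 / 2))).map (fun z => (⟨z.1, z.2⟩ : ℂ))

/-- The sources of randomness in the network: the whole process of transmitter positions, and,
for each pair `n`, the direction from `Tx_n` to `Rx_n` and the access decision, and, for each
`m, n`, the channels `Tx_n → Rx_m` and `Rx_n → Tx_m`. -/
inductive Source : Type
  | positions
  | direction (n : ℕ)
  | access (n : ℕ)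
  | forward (m n : ℕ)
  | reverse (m n : ℕ)

/-- A two-way ad-hoc network on the probability space `(Ω, P)` with density `lam` of active pairs.
Slotted Aloha: the pair `n` is active with probability `accessProb`. -/
structure Network {Ω : Type*} [MeasurableSpace Ω] (P : Measure Ω) (lam : ℝ) where
  /-- Density of all pairs, active or not. -/
  baseDensity : ℝ
  /-- The access probability. -/
  accessProb : ℝ
  baseDensity_pos : 0 < baseDensity
  accessProb_pos : 0 < accessProb
  accessProb_le_one : accessProb ≤ 1
  density_eq : lam = accessProb * baseDensity
  /-- Location of `Tx_n`. -/
  T : ℕ → Ω → Plane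
  /-- Angle of the direction from `Tx_n` to `Rx_n`. -/
  angle : ℕ → Ω → ℝ
  /-- Whether the pair `(Tx_n, Rx_n)` is active. -/
  active : ℕ → Ω → Bool
  /-- `h m n` is the channel from `Tx_n` to `Rx_m`. -/
  h : ℕ → ℕ → Ω → ℂ
  /-- `g m n` is the channel from `Rx_n` to `Tx_m`. -/
  g : ℕ → ℕ → Ω → ℂ
  ppp_T : IsHomogeneousPPP P baseDensity T
  measurable_angle : ∀ n, Measurable (angle n)
  uniform_angle : ∀ n, pdf.IsUniform (angle n) (Set.Ico 0 (2 * Real.pi)) P volume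
  measurable_active : ∀ n, Measurable (active n)
  prob_active : ∀ n, P.real {ω | active n ω = true} = accessProb
  measurable_h : ∀ m n, Measurable (h m n)
  measurable_g : ∀ m n, Measurable (g m n)
  law_h : ∀ m n, P.map (h m n) = complexGaussian
  law_g : ∀ m n, P.map (g m n) = complexGaussian
  indep : iIndep (fun s : Source => match s with
    | .positions => ⨆ n, MeasurableSpace.comap (T n) inferInstance
    | .direction n => MeasurableSpace.comap (angle n) inferInstance
    | .access n => MeasurableSpace.comap (active n) inferInstance
    | .forward m n => MeasurableSpace.comap (h m n) inferInstance
    | .reverse m n => MeasurableSpace.comap (g m n) inferInstance) P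

namespace Network

variable {Ω : Type*} [MeasurableSpace Ω] {P : Measure Ω} {lam : ℝ}

/-- Location of `Rx_n`, at distance `d` from `Tx_n`. -/
def R (N : Network P lam) (d : ℝ) (n : ℕ) (ω : Ω) : Plane :=
  N.T n ω + d • !₂[Real.cos (N.angle n ω), Real.sin (N.angle n ω)]

/-- Interference at `Rx_m` from all other active transmitters. -/
def interferenceTR (N : Network P lam) (α d : ℝ) (m : ℕ) (ω : Ω) : ℝ≥0∞ :=
  ∑' n, if n ≠ m ∧ N.active n ω = true then
    edist (N.T n ω) (N.R d m ω) ^ (-α) * ‖N.h m n ω‖ₑ ^ 2 else 0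

/-- Interference at `Tx_m` from all other active receivers. -/
def interferenceRT (N : Network P lam) (α d : ℝ) (m : ℕ) (ω : Ω) : ℝ≥0∞ :=
  ∑' n, if n ≠ m ∧ N.active n ω = true then
    edist (N.R d n ω) (N.T m ω) ^ (-α) * ‖N.g m n ω‖ₑ ^ 2 else 0

/-- Signal-to-interference ratio for `Tx_m → Rx_m`. -/
def sirTR (N : Network P lam) (α d : ℝ) (m : ℕ) (ω : Ω) : ℝ≥0∞ :=
  ENNReal.ofReal d ^ (-α) * ‖N.h m m ω‖ₑ ^ 2 / N.interferenceTR α d m ω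

/-- Signal-to-interference ratio for `Rx_m → Tx_m`. -/
def sirRT (N : Network P lam) (α d : ℝ) (m : ℕ) (ω : Ω) : ℝ≥0∞ :=
  ENNReal.ofReal d ^ (-α) * ‖N.g m m ω‖ₑ ^ 2 / N.interferenceRT α d m ω

end Network

/-- Mutual information `F * log₂ (1 + SIR)` over bandwidth `F`. -/
def mutualInfo (F : ℝ) (sir : ℝ≥0∞) : EReal :=
  ((F / Real.log 2 : ℝ) : EReal) * ENNReal.log (1 + sir)

/-- Path-loss exponent, distance within each pair, total bandwidth, bandwidth of the direction
`Tx → Rx`, and the rate demands of the two directions. -/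
structure Params where
  α : ℝ
  d : ℝ
  Ftotal : ℝ
  FTR : ℝ
  BTR : ℝ
  BRT : ℝ

namespace Params

/-- Bandwidth of the direction `Rx → Tx`. -/
def FRT (q : Params) : ℝ := q.Ftotal - q.FTR

def β₁ (q : Params) : ℝ := q.d ^ q.α * ((2 : ℝ) ^ (q.BTR / q.FTR) - 1)

def β₂ (q : Params) : ℝ := q.d ^ q.α * ((2 : ℝ) ^ (q.BRT / q.FRT) - 1)

/-- `c₁ = 2 π² csc(2π/α) / α`. -/
def c₁ (q : Params) : ℝ := 2 * Real.pi ^ 2 * (Real.sin (2 * Real.pi / q.α))⁻¹ / q.α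

/-- `c₂ = π² csc(2π/α) (α + 2) / α²`. -/
def c₂ (q : Params) : ℝ :=
  Real.pi ^ 2 * (Real.sin (2 * Real.pi / q.α))⁻¹ * (q.α + 2) / q.α ^ 2

end Params

/-- The unit square. -/
def unitSquare : Set Plane := {x | ∀ i, x i ∈ Set.Ico (0 : ℝ) 1}

namespace Network

variable {Ω : Type*} [MeasurableSpace Ω] {P : Measure Ω} {lam : ℝ}

/-- Communication of the pair `m` succeeds in both directions simultaneously. -/
def Success (N : Network P lam) (q : Params) (m : ℕ) (ω : Ω) : Prop :=
  (q.BTR : EReal) < mutualInfo q.FTR (N.sirTR q.α q.d m ω) ∧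
  (q.BRT : EReal) < mutualInfo q.FRT (N.sirRT q.α q.d m ω)

/-- Success probability of the typical active pair (its Palm probability): the expected number of
active successful pairs with transmitter in the unit square, divided by the expected number of
active pairs with transmitter in the unit square. -/
def successProb (N : Network P lam) (q : Params) : ℝ :=
  ((∫⁻ ω, ({m | N.T m ω ∈ unitSquare ∧ N.active m ω = true ∧ N.Success q m ω}.encard : ℝ≥0∞) ∂P) /
   (∫⁻ ω, ({m | N.T m ω ∈ unitSquare ∧ N.active m ω = true}.encard : ℝ≥0∞) ∂P)).toReal

end Network

/-- The densities `l > 0` at which the success probability `p l` meets the outage constraint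
`ε`. -/
def admissibleDensities (p : Set.Ioi (0 : ℝ) → ℝ) (ε : ℝ) : Set ℝ :=
  {l | ∃ hl : 0 < l, 1 - ε ≤ p ⟨l, hl⟩}

/-- The largest density meeting the outage constraint. -/
def maxDensity (p : Set.Ioi (0 : ℝ) → ℝ) (ε : ℝ) : ℝ := sSup (admissibleDensities p ε)

/-- The two-way transmission capacity, for the success probability `p l` at density `l`. -/
def capacity (q : Params) (p : Set.Ioi (0 : ℝ) → ℝ) (ε : ℝ) : ℝ :=
  (1 - ε) * maxDensity p ε * ((q.BTR + q.BRT) / q.Ftotal)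

end TwoWay

end

noncomputable section

namespace TwoWay

open Filter Topology

/-! ### The function `exp (-x)` on the extended nonnegative reals -/

/-- The function `x ↦ exp (-x)` on `[0, ∞]`. -/
def expNeg (x : ℝ≥0∞) : ℝ≥0∞ := EReal.exp (-(x : EReal))

@[simp] lemma expNeg_zero : expNeg 0 = 1 := by simp [expNeg]

@[simp] lemma expNeg_top : expNeg ∞ = 0 := by simp [expNeg]

lemma expNeg_ofReal {x : ℝ} (hx : 0 ≤ x) :
    expNeg (ENNReal.ofReal x) = ENNReal.ofReal (Real.exp (-x)) := by
  rw [expNeg, EReal.coe_ennreal_ofReal, max_eq_left hx, ← EReal.coe_neg, EReal.exp_coe]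

lemma expNeg_add (x y : ℝ≥0∞) : expNeg (x + y) = expNeg x * expNeg y := by
  have h : -((x + y : ℝ≥0∞) : EReal) = -(x : EReal) + -(y : EReal) := by
    rw [EReal.coe_ennreal_add, EReal.neg_add]
    · rw [sub_eq_add_neg]
    · left; simp
    · right; simp
  rw [expNeg, h, EReal.exp_add, expNeg, expNeg]

lemma expNeg_antitone : Antitone expNeg := fun x y h =>
  EReal.exp_monotone (EReal.neg_le_neg_iff.2 (by exact_mod_cast h))

lemma expNeg_le_one (x : ℝ≥0∞) : expNeg x ≤ 1 := by
  simpa using expNeg_antitone (zero_le (a := x))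

lemma continuous_expNeg : Continuous expNeg :=
  ENNReal.continuous_exp.comp (continuous_neg.comp continuous_coe_ennreal_ereal)

lemma measurable_expNeg : Measurable expNeg := continuous_expNeg.measurable

lemma expNeg_sum {ι : Type*} (s : Finset ι) (f : ι → ℝ≥0∞) :
    expNeg (∑ i ∈ s, f i) = ∏ i ∈ s, expNeg (f i) := by
  classical
  induction s using Finset.induction_on with
  | empty => simp
  | insert a s ha ih => rw [Finset.sum_insert ha, Finset.prod_insert ha, expNeg_add, ih]

/-! ### Infinite products of numbers in `[0, 1]` -/

/-- The infinite product of a sequence of numbers in `[0, 1]`. -/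
def infProd (f : ℕ → ℝ≥0∞) : ℝ≥0∞ := ⨅ N, ∏ n ∈ Finset.range N, f n

lemma antitone_prod_range {f : ℕ → ℝ≥0∞} (hf : ∀ n, f n ≤ 1) :
    Antitone fun N => ∏ n ∈ Finset.range N, f n :=
  antitone_nat_of_succ_le fun N => by
    rw [Finset.prod_range_succ]
    exact mul_le_of_le_one_right' (hf N)

lemma tendsto_infProd {f : ℕ → ℝ≥0∞} (hf : ∀ n, f n ≤ 1) :
    Tendsto (fun N => ∏ n ∈ Finset.range N, f n) atTop (𝓝 (infProd f)) :=
  tendsto_atTop_iInf (antitone_prod_range hf)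

lemma infProd_le_one (f : ℕ → ℝ≥0∞) : infProd f ≤ 1 :=
  (iInf_le (fun N => ∏ n ∈ Finset.range N, f n) 0).trans_eq (by simp)

lemma expNeg_tsum (f : ℕ → ℝ≥0∞) : expNeg (∑' n, f n) = infProd fun n => expNeg (f n) := by
  refine tendsto_nhds_unique ?_ (tendsto_infProd fun n => expNeg_le_one (f n))
  simp_rw [← expNeg_sum]
  exact (continuous_expNeg.tendsto _).comp (ENNReal.tendsto_nat_tsum f)

lemma infProd_eq_prod {f : ℕ → ℝ≥0∞} (hf : ∀ n, f n ≤ 1) (s : Finset ℕ)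
    (hs : ∀ n ∉ s, f n = 1) : infProd f = ∏ n ∈ s, f n := by
  refine tendsto_nhds_unique (tendsto_infProd hf) ?_
  obtain ⟨M, hM⟩ := s.exists_nat_subset_range
  refine tendsto_const_nhds.congr' ?_
  filter_upwards [eventually_ge_atTop M] with N hN
  exact Finset.prod_subset (hM.trans (by simpa using hN)) fun n _ hn => hs n hn

lemma infProd_mul {f g : ℕ → ℝ≥0∞} (hf : ∀ n, f n ≤ 1) (hg : ∀ n, g n ≤ 1) :
    infProd (fun n => f n * g n) = infProd f * infProd g := by
  refine tendsto_nhds_unique (tendsto_infProd fun n => mul_le_one' (hf n) (hg n)) ?_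
  simp_rw [Finset.prod_mul_distrib]
  exact ENNReal.Tendsto.mul (tendsto_infProd hf)
    (Or.inr ((infProd_le_one g).trans_lt ENNReal.one_lt_top).ne) (tendsto_infProd hg)
    (Or.inr ((infProd_le_one f).trans_lt ENNReal.one_lt_top).ne)

lemma measurable_infProd {X : Type*} [MeasurableSpace X] {f : ℕ → X → ℝ≥0∞}
    (hf : ∀ n, Measurable (f n)) : Measurable fun x => infProd fun n => f n x :=
  Measurable.iInf fun _ => Finset.measurable_fun_prod _ fun n _ => hf n

/-! ### Moments of Poisson variables -/

lemma lintegral_poissonMeasure (r : NNReal) (f : ℕ → ℝ≥0∞) :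
    ∫⁻ k, f k ∂poissonMeasure r =
      ∑' k, ENNReal.ofReal (Real.exp (-r) * r ^ k / k.factorial) * f k := by
  simp [poissonMeasure, lintegral_sum_measure, lintegral_smul_measure, lintegral_dirac]

lemma hasSum_poisson_pgf (r c : ℝ) :
    HasSum (fun k : ℕ => Real.exp (-r) * r ^ k / k.factorial * c ^ k)
      (Real.exp (-(r * (1 - c)))) := by
  have h := (NormedSpace.expSeries_div_hasSum_exp (r * c : ℝ)).mul_left (Real.exp (-r))
  rw [← Real.exp_eq_exp_ℝ, ← Real.exp_add] at h
  have h2 : -(r * (1 - c)) = -r + r * c := by ring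
  rw [h2]
  refine h.congr_fun fun k => ?_
  rw [mul_pow]; ring

lemma lintegral_pow_poissonMeasure (r : NNReal) {c : ℝ≥0∞} (hc : c ≤ 1) :
    ∫⁻ k, c ^ k ∂poissonMeasure r = expNeg (r * (1 - c)) := by
  lift c to NNReal using (hc.trans_lt ENNReal.one_lt_top).ne
  have hc' : (c : ℝ) ≤ 1 := by exact_mod_cast hc
  have h := hasSum_poisson_pgf r c
  have hr : (r : ℝ≥0∞) * (1 - c) = ENNReal.ofReal (r * (1 - c)) := by
    rw [ENNReal.ofReal_mul (by positivity), ENNReal.ofReal_sub _ (by positivity)]; simp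
  rw [lintegral_poissonMeasure, hr, expNeg_ofReal (mul_nonneg r.coe_nonneg (by linarith)), ← h.tsum_eq,
    ENNReal.ofReal_tsum_of_nonneg (fun k => by positivity) h.summable]
  refine tsum_congr fun k => ?_
  rw [ENNReal.ofReal_mul (by positivity), ENNReal.ofReal_pow (by positivity)]
  simp

lemma lintegral_mul_pow_poissonMeasure (r : NNReal) {c : ℝ≥0∞} (hc : c ≤ 1) :
    ∫⁻ k, k * c ^ (k - 1) ∂poissonMeasure r = r * expNeg (r * (1 - c)) := by
  rw [← lintegral_pow_poissonMeasure r hc, lintegral_poissonMeasure, lintegral_poissonMeasure,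
    tsum_eq_zero_add' ENNReal.summable, ← ENNReal.tsum_mul_left]
  simp only [Nat.cast_zero, zero_mul, mul_zero, zero_add, add_tsub_cancel_right]
  refine tsum_congr fun k => ?_
  have h : ENNReal.ofReal (Real.exp (-r) * r ^ (k + 1) / (k + 1).factorial) * ((k + 1 : ℕ) : ℝ≥0∞)
      = r * ENNReal.ofReal (Real.exp (-r) * r ^ k / k.factorial) := by
    rw [← ENNReal.ofReal_natCast, ← ENNReal.ofReal_mul (by positivity), ← ENNReal.ofReal_coe_nnreal,
      ← ENNReal.ofReal_mul (by positivity)]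
    congr 1
    rw [Nat.factorial_succ]
    push_cast
    field_simp
    ring
  rw [← mul_assoc, h, mul_assoc]

/-! ### Counting the points of a Poisson point process -/

section Counts

variable {Ω : Type*} [MeasurableSpace Ω] {P : Measure Ω} {lam : ℝ} {T : ℕ → Ω → Plane}

lemma encard_eq_tsum_indicator (s : Set ℕ) :
    (s.encard : ℝ≥0∞) = ∑' n, s.indicator 1 n := by
  rw [← ENNReal.tsum_set_one, tsum_subtype s (fun _ => (1 : ℝ≥0∞))]; rfl

lemma measurable_encard {X : Type*} [MeasurableSpace X] {A : ℕ → Set X}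
    (hA : ∀ n, MeasurableSet (A n)) :
    Measurable fun x => ({n | x ∈ A n}.encard : ℝ≥0∞) := by
  simp_rw [encard_eq_tsum_indicator]
  refine Measurable.tsum fun n => ?_
  exact (measurable_const (a := (1 : ℝ≥0∞))).indicator (hA n)

lemma measurableSet_encard_eq {X : Type*} [MeasurableSpace X] {A : ℕ → Set X}
    (hA : ∀ n, MeasurableSet (A n)) (k : ℕ) : MeasurableSet {x | {n | x ∈ A n}.encard = k} := by
  have : {x | {n | x ∈ A n}.encard = k}
      = (fun x => ({n | x ∈ A n}.encard : ℝ≥0∞)) ⁻¹' {(k : ℝ≥0∞)} := by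
    ext x
    simp only [Set.mem_ofPred_eq, Set.mem_preimage, Set.mem_singleton_iff]
    rw [← ENat.toENNReal_coe, ENat.toENNReal_inj]
  rw [this]
  exact measurable_encard hA (measurableSet_singleton _)

variable [IsProbabilityMeasure P]

lemma IsHomogeneousPPP.ae_finite (hT : IsHomogeneousPPP P lam T) (hlam : 0 ≤ lam) {B : Set Plane}
    (hB : MeasurableSet B) (hB' : volume B < ∞) : ∀ᵐ ω ∂P, {n | T n ω ∈ B}.Finite := by
  have hm : ∀ k : ℕ, MeasurableSet {ω | {n | T n ω ∈ B}.encard = k} := fun k =>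
    measurableSet_encard_eq (A := fun n => T n ⁻¹' B) (fun n => hT.1 n hB) k
  have hU : P (⋃ k : ℕ, {ω | {n | T n ω ∈ B}.encard = k}) = 1 := by
    rw [measure_iUnion _ hm]
    · have h := hasSum_one_poissonMeasure (lam * volume.real B).toNNReal
      rw [Real.coe_toNNReal _ (by positivity)] at h
      have h2 : ∀ k : ℕ, P {ω | {n | T n ω ∈ B}.encard = k} =
          ENNReal.ofReal (Real.exp (-(lam * volume.real B)) * (lam * volume.real B) ^ k
            / k.factorial) := by
        intro k
        have := hT.2 1 (fun _ => B) (fun _ => k) (fun _ => hB) (fun _ => hB')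
          (fun i j hij => (hij (Subsingleton.elim i j)).elim)
        simp only [forall_const, Finset.univ_unique, Finset.prod_singleton] at this
        rw [← this, ofReal_measureReal]
      simp_rw [h2]
      rw [← ENNReal.ofReal_tsum_of_nonneg (fun k => by positivity) h.summable]
      simpa using congrArg ENNReal.ofReal h.tsum_eq
    · intro i j hij
      refine Set.disjoint_left.2 fun ω hi hj => hij ?_
      simp only [Set.mem_ofPred_eq] at hi hj
      exact_mod_cast hi.symm.trans hj
  have := (prob_compl_eq_zero_iff (MeasurableSet.iUnion hm)).2 hU
  refine measure_mono_null (fun ω hω => ?_) this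
  simp only [Set.mem_compl_iff, Set.mem_iUnion, Set.mem_ofPred_eq, not_exists] at hω ⊢
  intro k hk
  exact hω (Set.finite_of_encard_eq_coe hk)

lemma measurable_ncard (hT : ∀ n, Measurable (T n)) {B : Set Plane} (hB : MeasurableSet B) :
    Measurable fun ω => {n | T n ω ∈ B}.ncard := by
  have h := measurable_encard (A := fun n => T n ⁻¹' B) (fun n => hT n hB)
  have h2 : Measurable fun ω => ({n | T n ω ∈ B}.ncard : ℝ≥0∞).toReal := by
    have : (fun ω => ({n | T n ω ∈ B}.ncard : ℝ≥0∞).toReal) =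
        fun ω => ({n | ω ∈ T n ⁻¹' B}.encard : ℝ≥0∞).toReal := by
      ext ω
      change _ = (({n | T n ω ∈ B}.encard : ℕ∞) : ℝ≥0∞).toReal
      rcases Set.finite_or_infinite {n | T n ω ∈ B} with hf | hf
      · rw [← hf.cast_ncard_eq]; simp
      · rw [hf.ncard, hf.encard_eq]; simp
    rw [this]; exact h.ennreal_toReal
  simp only [ENNReal.toReal_natCast] at h2
  exact (MeasurableEmbedding.natCast (α := ℝ)).measurable_comp_iff.1 h2

/-- The law of the numbers of points in disjoint sets of finite area. -/
lemma IsHomogeneousPPP.map_ncard (hT : IsHomogeneousPPP P lam T) (hlam : 0 ≤ lam)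
    {ι : Type*} [Fintype ι] {B : ι → Set Plane} (hB : ∀ i, MeasurableSet (B i))
    (hB' : ∀ i, volume (B i) < ∞) (hd : Pairwise (Function.onFun Disjoint B)) :
    P.map (fun ω i => {n | T n ω ∈ B i}.ncard) =
      Measure.pi fun i => poissonMeasure (lam * volume.real (B i)).toNNReal := by
  have hmeas : Measurable (fun ω i => {n | T n ω ∈ B i}.ncard) :=
    measurable_pi_lambda _ fun i => measurable_ncard hT.1 (hB i)
  refine Measure.ext_of_singleton fun k => ?_
  rw [Measure.map_apply hmeas (measurableSet_singleton _), Measure.pi_singleton]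
  let e := Fintype.equivFin ι
  have h := hT.2 _ (B ∘ e.symm) (k ∘ e.symm) (fun i => hB _) (fun i => hB' _)
    (fun i j hij => hd (e.symm.injective.ne hij))
  have hfin : ∀ᵐ ω ∂P, ∀ i, {n | T n ω ∈ B i}.Finite :=
    ae_all_iff.2 fun i => hT.ae_finite hlam (hB i) (hB' i)
  have heq : P ((fun ω i => {n | T n ω ∈ B i}.ncard) ⁻¹' {k}) =
      P {ω | ∀ i, {n | T n ω ∈ (B ∘ e.symm) i}.encard = (k ∘ e.symm) i} := by
    refine measure_congr (Filter.eventuallyEq_set.2 ?_)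
    filter_upwards [hfin] with ω hω
    simp only [Set.mem_preimage, Set.mem_singleton_iff, funext_iff, Function.comp_apply]
    rw [← e.symm.forall_congr_right (q := fun i => Set.ncard {n | T n ω ∈ B i} = k i)]
    refine forall_congr' fun i => ?_
    rw [← (hω (e.symm i)).cast_ncard_eq]
    norm_cast
  rw [heq, ← ofReal_measureReal, h, ENNReal.ofReal_prod_of_nonneg (fun i _ => by positivity),
    ← Equiv.prod_comp e]
  refine Finset.prod_congr rfl fun i _ => ?_
  rw [poissonMeasure_singleton, Real.coe_toNNReal _ (by positivity)]
  simp

end Counts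

section Mecke

/-! ### The Mecke formula for product functionals -/

lemma setLIntegral_comp_fintype {ι : Type*} [Fintype ι] [MeasurableSpace ι]
    [MeasurableSingletonClass ι] {ρ : Plane → ι} (hρ : Measurable ρ) (W : Set Plane)
    (g : ι → ℝ≥0∞) :
    ∫⁻ y in W, g (ρ y) = ∑ i, g i * volume (W ∩ ρ ⁻¹' {i}) := by
  rw [← lintegral_map (measurable_of_finite g) hρ, lintegral_fintype]
  refine Finset.sum_congr rfl fun i _ => ?_
  rw [Measure.map_apply hρ (measurableSet_singleton i),
    Measure.restrict_apply (hρ (measurableSet_singleton i)), Set.inter_comm]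

/-- The sum over the points of a pattern of a product functional of the other points in the
window `W`. -/
def productSum (Φ : Plane → Plane → ℝ≥0∞) (a : Plane → ℝ≥0∞) (W : Set Plane)
    (t : ℕ → Plane) : ℝ≥0∞ :=
  ∑' m, a (t m) * infProd fun n => open Classical in
    if n ≠ m ∧ t n ∈ W then Φ (t m) (t n) else 1

lemma productSum_eq_sum {Φ : Plane → Plane → ℝ≥0∞} (hΦ : ∀ x y, Φ x y ≤ 1)
    {a : Plane → ℝ≥0∞} {W : Set Plane} (ha : ∀ x ∉ W, a x = 0) {t : ℕ → Plane}
    (hf : {n | t n ∈ W}.Finite) :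
    productSum Φ a W t = ∑ m ∈ hf.toFinset, a (t m) * ∏ n ∈ hf.toFinset.erase m, Φ (t m) (t n) := by
  rw [productSum, tsum_eq_sum (s := hf.toFinset) fun m hm => by
    rw [ha _ (by simpa using hm), zero_mul]]
  refine Finset.sum_congr rfl fun m _ => ?_
  rw [infProd_eq_prod (fun n => by split_ifs <;> simp [hΦ]) (hf.toFinset.erase m)]
  · congr 1
    refine Finset.prod_congr rfl fun n hn => ?_
    rw [if_pos (by simpa using hn)]
  · intro n hn
    rw [if_neg (by simpa using hn)]

lemma productSum_discrete {ι : Type*} [Fintype ι] [DecidableEq ι] (ρ : Plane → ι) {W : Set Plane}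
    {c : ι → ι → ℝ≥0∞} (hc : ∀ i j, c i j ≤ 1) (a : ι → ℝ≥0∞) {t : ℕ → Plane}
    (hf : {n | t n ∈ W}.Finite) :
    productSum (fun x y => c (ρ x) (ρ y)) (W.indicator fun x => a (ρ x)) W t =
      ∑ j, a j * ∏ i, if i = j then
        ({n | t n ∈ W ∩ ρ ⁻¹' {i}}.ncard : ℝ≥0∞) * c j i ^ ({n | t n ∈ W ∩ ρ ⁻¹' {i}}.ncard - 1)
        else c j i ^ {n | t n ∈ W ∩ ρ ⁻¹' {i}}.ncard := by
  rw [productSum_eq_sum (fun x y => hc _ _) (fun x hx => by simp [hx]) hf]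
  have hcard : ∀ i, {n | t n ∈ W ∩ ρ ⁻¹' {i}}.ncard =
      (hf.toFinset.filter fun n => ρ (t n) = i).card := by
    intro i
    rw [← Set.ncard_coe_finset]
    congr 1
    ext n
    simp
  simp_rw [hcard]
  rw [← Finset.sum_fiberwise hf.toFinset fun m => ρ (t m)]
  refine Finset.sum_congr rfl fun j _ => ?_
  have hprod : ∀ m ∈ hf.toFinset.filter (fun n => ρ (t n) = j),
      W.indicator (fun x => a (ρ x)) (t m) * ∏ n ∈ hf.toFinset.erase m, c (ρ (t m)) (ρ (t n)) =
      a j * ∏ i, if i = j then c j i ^ ((hf.toFinset.filter fun n => ρ (t n) = i).card - 1)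
        else c j i ^ (hf.toFinset.filter fun n => ρ (t n) = i).card := by
    intro m hm
    simp only [Finset.mem_filter, Set.Finite.mem_toFinset, Set.mem_ofPred_eq] at hm
    rw [Set.indicator_of_mem hm.1, hm.2, ← Finset.prod_fiberwise _ (fun n => ρ (t n))]
    congr 1
    refine Finset.prod_congr rfl fun i _ => ?_
    rw [Finset.prod_congr rfl (g := fun _ => c j i)
      (fun n hn => by rw [(Finset.mem_filter.1 hn).2]), Finset.prod_const]
    split_ifs with hij
    · subst hij
      rw [Finset.filter_erase, Finset.card_erase_of_mem (by simp [hm])]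
    · rw [Finset.filter_erase, Finset.erase_eq_of_notMem]
      simp only [Finset.mem_filter, not_and]
      intro _ h
      exact hij (h.symm.trans hm.2)
  rw [Finset.sum_congr rfl hprod, Finset.sum_const, nsmul_eq_mul, ← mul_assoc, mul_comm _ (a j),
    mul_assoc]
  congr 1
  rw [← Finset.mul_prod_erase _ _ (Finset.mem_univ j), ← Finset.mul_prod_erase _ _ (Finset.mem_univ j),
    if_pos rfl, if_pos rfl, mul_assoc]
  congr 2
  refine Finset.prod_congr rfl fun i hi => ?_
  rw [if_neg (Finset.ne_of_mem_erase hi), if_neg (Finset.ne_of_mem_erase hi)]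

variable {Ω : Type*} [MeasurableSpace Ω] {P : Measure Ω} {lam : ℝ} {T : ℕ → Ω → Plane}
  [IsProbabilityMeasure P]

lemma IsHomogeneousPPP.lintegral_productSum_discrete (hT : IsHomogeneousPPP P lam T)
    (hlam : 0 ≤ lam)
    {ι : Type*} [Fintype ι] [MeasurableSpace ι] [MeasurableSingletonClass ι]
    {ρ : Plane → ι} (hρ : Measurable ρ) {W : Set Plane} (hW : MeasurableSet W)
    (hW' : volume W < ∞) {c : ι → ι → ℝ≥0∞} (hc : ∀ i j, c i j ≤ 1) (a : ι → ℝ≥0∞) :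
    ∫⁻ ω, productSum (fun x y => c (ρ x) (ρ y)) (W.indicator fun x => a (ρ x)) W (T · ω) ∂P =
      ENNReal.ofReal lam * ∫⁻ x in W, a (ρ x) *
        expNeg (ENNReal.ofReal lam * ∫⁻ y in W, (1 - c (ρ x) (ρ y))) := by
  classical
  let B : ι → Set Plane := fun i => W ∩ ρ ⁻¹' {i}
  let κ : ι → Ω → ℕ := fun i ω => {n | T n ω ∈ B i}.ncard
  let r : ι → NNReal := fun i => (lam * volume.real (B i)).toNNReal
  have hB : ∀ i, MeasurableSet (B i) := fun i => hW.inter (hρ (measurableSet_singleton i))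
  have hB' : ∀ i, volume (B i) < ∞ := fun i => (measure_mono Set.inter_subset_left).trans_lt hW'
  have hd : Pairwise (Function.onFun Disjoint B) := by
    intro i j hij
    refine Set.disjoint_left.2 fun x hx hx' => hij ?_
    exact hx.2.symm.trans hx'.2
  have hκ : ∀ i, Measurable (κ i) := fun i => measurable_ncard hT.1 (hB i)
  have hmap := hT.map_ncard hlam hB hB' hd
  have hlaw : ∀ i, P.map (κ i) = poissonMeasure (r i) := by
    intro i
    have h1 : P.map (κ i) = (P.map fun ω i => κ i ω).map (fun k => k i) := by
      rw [Measure.map_map (measurable_pi_apply i) (measurable_pi_lambda _ hκ)]; rfl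
    rw [h1, hmap]
    exact (measurePreserving_eval _ i).map_eq
  have hind : iIndepFun κ P := by
    rw [iIndepFun_iff_map_fun_eq_pi_map fun i => (hκ i).aemeasurable]
    simp_rw [hlaw]
    exact hmap
  have hr : ∀ i, (r i : ℝ≥0∞) = ENNReal.ofReal lam * volume (B i) := by
    intro i
    change ENNReal.ofReal (lam * volume.real (B i)) = _
    rw [ENNReal.ofReal_mul hlam, ofReal_measureReal (hB' i).ne]
  let g : ι → ι → ℕ → ℝ≥0∞ := fun j i k => if i = j then (k : ℝ≥0∞) * c j i ^ (k - 1) else c j i ^ k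
  have hg : ∀ j i, Measurable (g j i) := fun j i => measurable_of_countable _
  have hgi : ∀ j i, ∫⁻ ω, g j i (κ i ω) ∂P =
      if i = j then r i * expNeg (r i * (1 - c j i)) else expNeg (r i * (1 - c j i)) := by
    intro j i
    rw [← lintegral_map (hg j i) (hκ i), hlaw]
    by_cases hij : i = j
    · simp only [g, if_pos hij]; exact lintegral_mul_pow_poissonMeasure _ (hc _ _)
    · simp only [g, if_neg hij]; exact lintegral_pow_poissonMeasure _ (hc _ _)
  have hexp : ∀ j, ENNReal.ofReal lam * ∫⁻ y in W, (1 - c j (ρ y)) = ∑ i, r i * (1 - c j i) := by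
    intro j
    rw [setLIntegral_comp_fintype hρ W fun i => 1 - c j i, Finset.mul_sum]
    refine Finset.sum_congr rfl fun i _ => ?_
    rw [hr]; ring
  calc ∫⁻ ω, productSum (fun x y => c (ρ x) (ρ y)) (W.indicator fun x => a (ρ x)) W (T · ω) ∂P
      = ∫⁻ ω, ∑ j, a j * ∏ i, g j i (κ i ω) ∂P := by
        refine lintegral_congr_ae ?_
        filter_upwards [hT.ae_finite hlam hW hW'] with ω hω
        exact productSum_discrete ρ hc a hω
    _ = ∑ j, a j * ∏ i, ∫⁻ ω, g j i (κ i ω) ∂P := by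
        have hm : ∀ j, Measurable fun ω => ∏ i, g j i (κ i ω) := fun j =>
          Finset.measurable_fun_prod _ fun i _ => (hg j i).comp (hκ i)
        rw [lintegral_finsetSum _ fun j _ => (hm j).const_mul _]
        refine Finset.sum_congr rfl fun j _ => ?_
        rw [lintegral_const_mul _ (hm j)]
        congr 1
        exact lintegral_prod_eq_prod_lintegral_of_indepFun Finset.univ
          (fun i ω => g j i (κ i ω)) (hind.comp (g j) (hg j)) (fun i => (hg j i).comp (hκ i))
    _ = _ := by
        simp_rw [hexp]
        rw [setLIntegral_comp_fintype hρ W (fun j => a j * expNeg (∑ i, r i * (1 - c j i))),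
          Finset.mul_sum]
        refine Finset.sum_congr rfl fun j _ => ?_
        simp_rw [hgi]
        rw [expNeg_sum, ← Finset.mul_prod_erase _ _ (Finset.mem_univ j),
          ← Finset.mul_prod_erase Finset.univ (fun i => expNeg _) (Finset.mem_univ j),
          if_pos rfl, Finset.prod_congr rfl fun i hi => if_neg (Finset.ne_of_mem_erase hi), hr]
        ring

lemma measurable_productSum {Φ : Plane → Plane → ℝ≥0∞} (hΦ : Measurable (Function.uncurry Φ))
    {a : Plane → ℝ≥0∞} (ha : Measurable a) {W : Set Plane} (hW : MeasurableSet W) :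
    Measurable (productSum Φ a W) := by
  classical
  refine Measurable.tsum fun m => (ha.comp (measurable_pi_apply m)).mul ?_
  refine measurable_infProd fun n => ?_
  refine Measurable.ite ?_ ?_ measurable_const
  · exact (MeasurableSet.const (n ≠ m)).inter (measurable_pi_apply (X := fun _ : ℕ => Plane) n hW)
  · exact hΦ.comp (f := fun t : ℕ → Plane => (t m, t n)) (by fun_prop)

lemma productSum_le {Φ : Plane → Plane → ℝ≥0∞} {a : Plane → ℝ≥0∞} {Q : Set Plane}
    (ha : ∀ x, a x ≤ Q.indicator 1 x) (W : Set Plane) (t : ℕ → Plane) :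
    productSum Φ a W t ≤ ({n | t n ∈ Q}.encard : ℝ≥0∞) := by
  rw [encard_eq_tsum_indicator]
  refine ENNReal.tsum_le_tsum fun m => ?_
  exact mul_le_of_le_one_right' (infProd_le_one _) |>.trans (ha (t m))

lemma productSum_one (Q : Set Plane) (W : Set Plane) (t : ℕ → Plane) :
    productSum (fun _ _ => 1) (Q.indicator 1) W t = ({n | t n ∈ Q}.encard : ℝ≥0∞) := by
  rw [encard_eq_tsum_indicator]
  refine tsum_congr fun m => ?_
  simp only [ite_self]
  rw [infProd_eq_prod (fun _ => le_rfl) ∅ (fun _ _ => rfl), Finset.prod_empty, mul_one]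
  rfl

lemma IsHomogeneousPPP.lintegral_encard (hT : IsHomogeneousPPP P lam T) (hlam : 0 ≤ lam)
    {Q : Set Plane} (hQ : MeasurableSet Q) (hQ' : volume Q < ∞) :
    ∫⁻ ω, ({n | T n ω ∈ Q}.encard : ℝ≥0∞) ∂P = ENNReal.ofReal lam * volume Q := by
  have h := hT.lintegral_productSum_discrete hlam (ρ := fun _ => ()) measurable_const hQ hQ'
    (c := fun _ _ => 1) (fun _ _ => le_rfl) (fun _ => 1)
  simp only [tsub_self, lintegral_zero, mul_zero, expNeg_zero, mul_one, lintegral_const, one_mul,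
    Measure.restrict_apply_univ] at h
  rw [← h]
  exact lintegral_congr fun ω => (productSum_one Q Q _).symm

/-- The Mecke formula in a bounded window. -/
lemma IsHomogeneousPPP.lintegral_productSum_window (hT : IsHomogeneousPPP P lam T)
    (hlam : 0 ≤ lam) {W Q : Set Plane} (hW : MeasurableSet W) (hW' : volume W < ∞)
    (hQ : MeasurableSet Q) (hQW : Q ⊆ W) {Φ : Plane → Plane → ℝ≥0∞}
    (hΦ : Continuous (Function.uncurry Φ)) (hΦ1 : ∀ x y, Φ x y ≤ 1) :
    ∫⁻ ω, productSum Φ (Q.indicator 1) W (T · ω) ∂P =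
      ENNReal.ofReal lam * ∫⁻ x in Q, expNeg (ENNReal.ofReal lam * ∫⁻ y in W, (1 - Φ x y)) := by
  classical
  let s : ℕ → SimpleFunc Plane Plane := fun k =>
    SimpleFunc.approxOn id measurable_id Set.univ 0 (Set.mem_univ 0) k
  have hs : ∀ x, Tendsto (fun k => s k x) atTop (𝓝 x) := fun x =>
    SimpleFunc.tendsto_approxOn measurable_id (Set.mem_univ _) (by simp)
  have hΦs : ∀ x y, Tendsto (fun k => Φ (s k x) (s k y)) atTop (𝓝 (Φ x y)) := fun x y =>
    (hΦ.tendsto (x, y)).comp ((hs x).prodMk_nhds (hs y))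
  have hΦt : ∀ x y, Φ x y ≠ ∞ := fun x y => ((hΦ1 x y).trans_lt ENNReal.one_lt_top).ne
  have hΦsm : ∀ k, Measurable (Function.uncurry fun x y => Φ (s k x) (s k y)) := fun k =>
    hΦ.measurable.comp (((s k).measurable.comp measurable_fst).prodMk
      ((s k).measurable.comp measurable_snd))
  have hQfin : volume Q < ∞ := (measure_mono hQW).trans_lt hW'
  have key : ∀ k, ∫⁻ ω, productSum (fun x y => Φ (s k x) (s k y)) (Q.indicator 1) W (T · ω) ∂P =
      ENNReal.ofReal lam * ∫⁻ x in Q, expNeg (ENNReal.ofReal lam *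
        ∫⁻ y in W, (1 - Φ (s k x) (s k y))) := by
    intro k
    let σ : SimpleFunc Plane (Plane × Bool) := (s k).pair
      (SimpleFunc.piecewise Q hQ (SimpleFunc.const _ true) (SimpleFunc.const _ false))
    let _ : MeasurableSpace σ.range := ⊤
    have : MeasurableSingletonClass σ.range := ⟨fun _ => trivial⟩
    let ρ : Plane → σ.range := fun x => ⟨σ x, σ.mem_range_self x⟩
    have hρ : Measurable ρ := measurable_to_countable' fun i => by
      have : ρ ⁻¹' {i} = σ ⁻¹' {(i : Plane × Bool)} := by
        ext x; simp [ρ, Subtype.ext_iff]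
      rw [this]; exact σ.measurableSet_fiber _
    have h := hT.lintegral_productSum_discrete hlam hρ hW hW'
      (c := fun i j => Φ i.1.1 j.1.1) (fun i j => hΦ1 _ _) (fun i => if i.1.2 then 1 else 0)
    have h1 : ∀ x, (ρ x).1.1 = s k x := fun x => rfl
    have h2 : ∀ x, (if (ρ x).1.2 = true then (1 : ℝ≥0∞) else 0) = Q.indicator 1 x := by
      intro x
      by_cases hx : x ∈ Q <;> simp [ρ, σ, hx]
    simp only [h1, h2] at h
    have h3 : W.indicator (fun x => Q.indicator (1 : Plane → ℝ≥0∞) x) = Q.indicator 1 := by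
      have : (fun x => Q.indicator (1 : Plane → ℝ≥0∞) x) = Q.indicator 1 := rfl
      rw [this, Set.indicator_indicator, Set.inter_eq_self_of_subset_right hQW]
    rw [h3] at h
    rw [h]
    congr 1
    have h4 : ∀ x, Q.indicator (1 : Plane → ℝ≥0∞) x * expNeg (ENNReal.ofReal lam *
        ∫⁻ y in W, (1 - Φ (s k x) (s k y))) = Q.indicator (fun x => expNeg (ENNReal.ofReal lam *
        ∫⁻ y in W, (1 - Φ (s k x) (s k y)))) x := by
      intro x
      by_cases hx : x ∈ Q <;> simp [hx]
    simp_rw [h4]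
    rw [lintegral_indicator hQ, Measure.restrict_restrict hQ,
      Set.inter_eq_self_of_subset_left hQW]
  have hinner : ∀ x, Tendsto (fun k => expNeg (ENNReal.ofReal lam *
      ∫⁻ y in W, (1 - Φ (s k x) (s k y)))) atTop
      (𝓝 (expNeg (ENNReal.ofReal lam * ∫⁻ y in W, (1 - Φ x y)))) := by
    intro x
    refine (continuous_expNeg.tendsto _).comp
      (ENNReal.Tendsto.const_mul ?_ (Or.inr ENNReal.ofReal_ne_top))
    refine tendsto_lintegral_of_dominated_convergence (fun _ => 1)
      (fun k => measurable_const.sub ((hΦsm k).comp measurable_prodMk_left))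
      (fun k => ae_of_all _ fun y => tsub_le_self) (by simpa using hW'.ne)
      (ae_of_all _ fun y => ENNReal.Tendsto.sub tendsto_const_nhds (hΦs x y) (by simp))
  have hright : Tendsto (fun k => ENNReal.ofReal lam * ∫⁻ x in Q, expNeg (ENNReal.ofReal lam *
      ∫⁻ y in W, (1 - Φ (s k x) (s k y)))) atTop (𝓝 (ENNReal.ofReal lam * ∫⁻ x in Q,
        expNeg (ENNReal.ofReal lam * ∫⁻ y in W, (1 - Φ x y)))) := by
    refine ENNReal.Tendsto.const_mul ?_ (Or.inr ENNReal.ofReal_ne_top)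
    refine tendsto_lintegral_of_dominated_convergence (fun _ => 1) (fun k => ?_)
      (fun k => ae_of_all _ fun y => expNeg_le_one _) (by simpa using hQfin.ne)
      (ae_of_all _ hinner)
    refine measurable_expNeg.comp (Measurable.const_mul ?_ _)
    exact Measurable.lintegral_prod_right (measurable_const.sub (hΦsm k))
  have hmQ : Measurable (Q.indicator (1 : Plane → ℝ≥0∞)) :=
    (measurable_const (a := (1 : ℝ≥0∞))).indicator hQ
  have hmT : Measurable fun ω => (fun n => T n ω) := measurable_pi_lambda _ hT.1
  have hleft : Tendsto (fun k => ∫⁻ ω, productSum (fun x y => Φ (s k x) (s k y))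
      (Q.indicator 1) W (T · ω) ∂P) atTop (𝓝 (∫⁻ ω, productSum Φ (Q.indicator 1) W (T · ω) ∂P)) := by
    refine tendsto_lintegral_of_dominated_convergence
      (fun ω => ({n | T n ω ∈ Q}.encard : ℝ≥0∞))
      (fun k => (measurable_productSum (hΦsm k) hmQ hW).comp hmT)
      (fun k => ae_of_all _ fun ω => productSum_le (fun _ => le_rfl) W _) ?_ ?_
    · rw [hT.lintegral_encard hlam hQ hQfin]
      exact ENNReal.mul_ne_top ENNReal.ofReal_ne_top hQfin.ne
    · filter_upwards [hT.ae_finite hlam hW hW'] with ω hω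
      have hQ0 : ∀ x ∉ W, Q.indicator (1 : Plane → ℝ≥0∞) x = 0 := fun x hx =>
        Set.indicator_of_notMem (fun h => hx (hQW h)) _
      simp_rw [productSum_eq_sum (fun x y => hΦ1 _ _) hQ0 hω]
      refine tendsto_finsetSum _ fun m _ => ENNReal.Tendsto.const_mul ?_ (Or.inr ?_)
      · exact ENNReal.tendsto_finsetProd_of_ne_top _ (fun n _ => hΦs _ _) (fun n _ => hΦt _ _)
      · by_cases h : T m ω ∈ Q <;> simp [h]
  simp_rw [key] at hleft
  exact tendsto_nhds_unique hleft hright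

/-- The Mecke formula for product functionals of a homogeneous Poisson point process. -/
theorem IsHomogeneousPPP.lintegral_productSum (hT : IsHomogeneousPPP P lam T)
    (hlam : 0 ≤ lam) {Q : Set Plane} (hQ : MeasurableSet Q) (hQfin : volume Q < ∞)
    {Φ : Plane → Plane → ℝ≥0∞}
    (hΦ : Continuous (Function.uncurry Φ)) (hΦ1 : ∀ x y, Φ x y ≤ 1) :
    ∫⁻ ω, productSum Φ (Q.indicator 1) Set.univ (T · ω) ∂P =
      ENNReal.ofReal lam * ∫⁻ x in Q, expNeg (ENNReal.ofReal lam * ∫⁻ y, (1 - Φ x y)) := by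
  classical
  let W : ℕ → Set Plane := fun R => Q ∪ Metric.ball 0 R
  have hW : ∀ R, MeasurableSet (W R) := fun R => hQ.union measurableSet_ball
  have hWfin : ∀ R, volume (W R) < ∞ := fun R =>
    measure_union_lt_top hQfin measure_ball_lt_top
  have hWmono : Monotone W := fun R S h =>
    Set.union_subset_union_right _ (Metric.ball_subset_ball (by exact_mod_cast h))
  have hWU : ⋃ R, W R = Set.univ := by
    refine Set.eq_univ_of_univ_subset ?_
    rw [← Metric.iUnion_ball_nat (0 : Plane)]
    exact Set.iUnion_mono fun R => Set.subset_union_right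
  have hmQ : Measurable (Q.indicator (1 : Plane → ℝ≥0∞)) :=
    (measurable_const (a := (1 : ℝ≥0∞))).indicator hQ
  have hmT : Measurable fun ω => (fun n => T n ω) := measurable_pi_lambda _ hT.1
  have hinner : ∀ x, Tendsto (fun R => expNeg (ENNReal.ofReal lam *
      ∫⁻ y in W R, (1 - Φ x y))) atTop
      (𝓝 (expNeg (ENNReal.ofReal lam * ∫⁻ y, (1 - Φ x y)))) := by
    intro x
    refine (continuous_expNeg.tendsto _).comp
      (ENNReal.Tendsto.const_mul ?_ (Or.inr ENNReal.ofReal_ne_top))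
    have h := setLIntegral_iUnion_of_directed (μ := volume) (fun y => 1 - Φ x y)
      hWmono.directed_le
    rw [hWU, Measure.restrict_univ] at h
    rw [h]
    exact tendsto_atTop_iSup fun R S h => lintegral_mono_set (hWmono h)
  have hright : Tendsto (fun R => ENNReal.ofReal lam * ∫⁻ x in Q, expNeg (ENNReal.ofReal lam *
      ∫⁻ y in W R, (1 - Φ x y))) atTop (𝓝 (ENNReal.ofReal lam * ∫⁻ x in Q,
        expNeg (ENNReal.ofReal lam * ∫⁻ y, (1 - Φ x y)))) := by
    refine ENNReal.Tendsto.const_mul ?_ (Or.inr ENNReal.ofReal_ne_top)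
    refine tendsto_lintegral_of_dominated_convergence (fun _ => 1) (fun k => ?_)
      (fun k => ae_of_all _ fun y => expNeg_le_one _) (by simpa using hQfin.ne)
      (ae_of_all _ hinner)
    refine measurable_expNeg.comp (Measurable.const_mul ?_ _)
    exact Measurable.lintegral_prod_right (measurable_const.sub hΦ.measurable)
  have hleft : Tendsto (fun R => ∫⁻ ω, productSum Φ
      (Q.indicator 1) (W R) (T · ω) ∂P) atTop
      (𝓝 (∫⁻ ω, productSum Φ (Q.indicator 1) Set.univ (T · ω) ∂P)) := by
    refine tendsto_lintegral_of_dominated_convergence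
      (fun ω => ({n | T n ω ∈ Q}.encard : ℝ≥0∞))
      (fun k => (measurable_productSum hΦ.measurable hmQ (hW k)).comp hmT)
      (fun k => ae_of_all _ fun ω => productSum_le (fun _ => le_rfl) _ _) ?_ ?_
    · rw [hT.lintegral_encard hlam hQ hQfin]
      exact ENNReal.mul_ne_top ENNReal.ofReal_ne_top hQfin.ne
    · filter_upwards [hT.ae_finite hlam hQ hQfin] with ω hω
      let F : Set Plane → ℕ → ℕ → ℝ≥0∞ := fun V m n =>
        if n ≠ m ∧ T n ω ∈ V then Φ (T m ω) (T n ω) else 1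
      have hsum : ∀ V, productSum Φ (Q.indicator 1) V (T · ω) = ∑ m ∈ hω.toFinset,
          Q.indicator 1 (T m ω) * infProd (F V m) := fun V =>
        tsum_eq_sum fun m hm => by
          rw [Set.indicator_of_notMem (by simpa using hm), zero_mul]
      simp_rw [hsum]
      refine tendsto_finsetSum _ fun m _ => ENNReal.Tendsto.const_mul ?_ (Or.inr ?_)
      · have hle : ∀ V n, F V m n ≤ 1 := fun V n => by
          simp only [F]; split_ifs <;> simp [hΦ1]
        have hlem : ∀ V V', V ⊆ V' → ∀ n, F V' m n ≤ F V m n := fun V V' h n => by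
          by_cases h1 : n ≠ m ∧ T n ω ∈ V
          · simp only [F]; rw [if_pos h1, if_pos ⟨h1.1, h h1.2⟩]
          · refine (hle V' n).trans_eq ?_
            simp only [F]; rw [if_neg h1]
        have hanti : Antitone fun R => infProd (F (W R) m) := fun R S h =>
          iInf_mono fun N => Finset.prod_le_prod' fun n _ => hlem _ _ (hWmono h) n
        have heq : infProd (F Set.univ m) = ⨅ R, infProd (F (W R) m) := by
          refine le_antisymm (le_iInf fun R => iInf_mono fun N =>
            Finset.prod_le_prod' fun n _ => hlem _ _ (Set.subset_univ _) n) ?_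
          refine le_iInf fun N => ?_
          have hex : ∃ R, ∀ n ∈ Finset.range N, T n ω ∈ W R := by
            have : ∀ n, ∃ R, T n ω ∈ W R := fun n => by
              have := Set.mem_univ (T n ω)
              rw [← hWU] at this
              simpa using this
            choose f hf using this
            exact ⟨(Finset.range N).sup f, fun n hn => hWmono (Finset.le_sup hn) (hf n)⟩
          obtain ⟨R, hR⟩ := hex
          refine (iInf_le _ R).trans ((iInf_le _ N).trans ?_)
          refine Finset.prod_le_prod' fun n hn => ?_
          simp [F, hR n hn]
        rw [heq]
        exact tendsto_atTop_iInf hanti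
      · by_cases h : T m ω ∈ Q <;> simp [h]
  refine tendsto_nhds_unique (hleft.congr fun R => ?_) hright
  exact hT.lintegral_productSum_window hlam (hW R) (hWfin R) hQ Set.subset_union_left hΦ hΦ1

end Mecke

/-! ### Squared modulus of a standard complex Gaussian variable -/

lemma lintegral_complexGaussian {F : ℝ≥0∞ → ℝ≥0∞} (hF : Measurable F) :
    ∫⁻ z, F (‖z‖ₑ ^ 2) ∂complexGaussian =
      ∫⁻ x in Set.Ioi (0 : ℝ), ENNReal.ofReal (Real.exp (-x)) * F (ENNReal.ofReal x) := by
  have hm : Measurable fun z : ℝ × ℝ => (⟨z.1, z.2⟩ : ℂ) :=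
    Complex.measurableEquivRealProd.symm.measurable
  have hpdf : ∀ x : ℝ, gaussianPDFReal 0 (1 / 2) x = (√Real.pi)⁻¹ * Real.exp (-x ^ 2) := by
    intro x
    rw [gaussianPDFReal]
    have : ((1 / 2 : NNReal) : ℝ) = 1 / 2 := by simp
    rw [this, show 2 * Real.pi * (1 / 2) = Real.pi by ring,
      show -(x - 0) ^ 2 / (2 * (1 / 2)) = -x ^ 2 by ring]
  have hnorm : ∀ z : ℝ × ℝ, ‖(⟨z.1, z.2⟩ : ℂ)‖ₑ ^ 2 = ENNReal.ofReal (z.1 ^ 2 + z.2 ^ 2) := by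
    intro z
    rw [← ofReal_norm, ← ENNReal.ofReal_pow (norm_nonneg _), Complex.sq_norm, Complex.normSq_mk]
    congr 1; ring
  rw [complexGaussian, lintegral_map (by fun_prop) hm,
    gaussianReal_of_var_ne_zero 0 (by norm_num : (1 / 2 : NNReal) ≠ 0),
    prod_withDensity (measurable_gaussianPDF _ _) (measurable_gaussianPDF _ _),
    lintegral_withDensity_eq_lintegral_mul _ (by fun_prop) (by fun_prop)]
  simp only [hnorm, Pi.mul_apply]
  have hdens : ∀ z : ℝ × ℝ, gaussianPDF 0 (1 / 2) z.1 * gaussianPDF 0 (1 / 2) z.2 =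
      ENNReal.ofReal (Real.pi⁻¹ * Real.exp (-(z.1 ^ 2 + z.2 ^ 2))) := by
    intro z
    rw [gaussianPDF, gaussianPDF, ← ENNReal.ofReal_mul (gaussianPDFReal_nonneg _ _ _), hpdf, hpdf]
    congr 1
    rw [neg_add, Real.exp_add]
    have : (√Real.pi)⁻¹ * (√Real.pi)⁻¹ = Real.pi⁻¹ := by
      rw [← mul_inv, Real.mul_self_sqrt Real.pi_pos.le]
    rw [← this]; ring
  simp_rw [hdens]
  change ∫⁻ z, ENNReal.ofReal (Real.pi⁻¹ * Real.exp (-(z.1 ^ 2 + z.2 ^ 2))) *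
    F (ENNReal.ofReal (z.1 ^ 2 + z.2 ^ 2)) ∂(volume : Measure (ℝ × ℝ)) = _
  rw [← lintegral_comp_polarCoord_symm]
  have hpol : ∀ p : ℝ × ℝ, (polarCoord.symm p).1 ^ 2 + (polarCoord.symm p).2 ^ 2 = p.1 ^ 2 := by
    intro p
    simp only [polarCoord_symm_apply]
    linear_combination p.1 ^ 2 * Real.cos_sq_add_sin_sq p.2
  simp_rw [hpol, smul_eq_mul]
  rw [polarCoord_target, Measure.volume_eq_prod, ← Measure.prod_restrict,
    lintegral_prod _ (by fun_prop)]
  simp only [lintegral_const, Measure.restrict_apply_univ, Real.volume_Ioo]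
  have himg : (fun x : ℝ => x ^ 2) '' Set.Ioi 0 = Set.Ioi 0 := by
    ext y
    simp only [Set.mem_image, Set.mem_Ioi]
    constructor
    · rintro ⟨x, hx, rfl⟩; positivity
    · intro hy; exact ⟨√y, Real.sqrt_pos.2 hy, Real.sq_sqrt hy.le⟩
  conv_rhs => rw [← himg]
  rw [lintegral_image_eq_lintegral_abs_deriv_mul measurableSet_Ioi
    (f' := fun x => 2 * x) (fun x _ => by simpa using (hasDerivAt_pow 2 x).hasDerivWithinAt)
    (fun x hx y hy h => (pow_left_inj₀ (le_of_lt hx) (le_of_lt hy) two_ne_zero).1 h)]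
  refine setLIntegral_congr_fun measurableSet_Ioi fun x hx => ?_
  have hx : 0 < x := hx
  rw [abs_of_pos (by positivity), ← mul_assoc, ← mul_assoc, mul_right_comm,
    ← ENNReal.ofReal_mul hx.le, ← ENNReal.ofReal_mul (by positivity),
    ← ENNReal.ofReal_mul (by positivity)]
  congr 2
  field_simp
  ring

/-- The squared modulus of a standard complex Gaussian variable is exponentially distributed. -/
lemma complexGaussian_tail (c : ℝ≥0∞) : complexGaussian {z | c < ‖z‖ₑ ^ 2} = expNeg c := by
  have hm : MeasurableSet {z : ℂ | c < ‖z‖ₑ ^ 2} := measurableSet_lt (by fun_prop) (by fun_prop)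
  have h := lintegral_complexGaussian (F := (Set.Ioi c).indicator 1)
    (measurable_const.indicator measurableSet_Ioi)
  have h1 : ∫⁻ z, (Set.Ioi c).indicator 1 (‖z‖ₑ ^ 2) ∂complexGaussian =
      complexGaussian {z | c < ‖z‖ₑ ^ 2} := by
    rw [← lintegral_indicator_one hm]; rfl
  rw [← h1, h]
  induction c with
  | top => simp
  | coe c =>
    have h2 : ∀ x ∈ Set.Ioi (0 : ℝ), ENNReal.ofReal (Real.exp (-x)) *
        (Set.Ioi (c : ℝ≥0∞)).indicator 1 (ENNReal.ofReal x) =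
        (Set.Ioi (c : ℝ)).indicator (fun x => ENNReal.ofReal (Real.exp (-x))) x := by
      intro x hx
      have : (c : ℝ≥0∞) < ENNReal.ofReal x ↔ (c : ℝ) < x := by
        rw [← ENNReal.ofReal_coe_nnreal, ENNReal.ofReal_lt_ofReal_iff hx]
      by_cases hc : (c : ℝ) < x
      · rw [Set.indicator_of_mem (s := Set.Ioi (c : ℝ≥0∞)) (this.2 hc), Set.indicator_of_mem (Set.mem_Ioi.2 hc)]; simp
      · rw [Set.indicator_of_notMem (s := Set.Ioi (c : ℝ≥0∞)) (fun h => hc (this.1 h)), Set.indicator_of_notMem (s := Set.Ioi (c : ℝ)) hc, mul_zero]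
    rw [setLIntegral_congr_fun measurableSet_Ioi h2, lintegral_indicator measurableSet_Ioi,
      Measure.restrict_restrict measurableSet_Ioi,
      Set.inter_eq_self_of_subset_left (Set.Ioi_subset_Ioi c.coe_nonneg),
      ← ofReal_integral_eq_lintegral_ofReal (integrableOn_exp_neg_Ioi _)
        (ae_of_all _ fun x => (Real.exp_pos _).le), integral_exp_neg_Ioi,
      ← ENNReal.ofReal_coe_nnreal, expNeg_ofReal c.coe_nonneg]

instance : IsProbabilityMeasure complexGaussian := by
  rw [complexGaussian]
  exact Measure.isProbabilityMeasure_map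
    (Complex.measurableEquivRealProd.symm.measurable.aemeasurable)

lemma lintegral_rpow_mul_exp_neg_mul_Ioi {a r : ℝ} (ha : 0 < a) (hr : 0 < r) :
    ∫⁻ t in Set.Ioi (0 : ℝ), ENNReal.ofReal (t ^ (a - 1) * Real.exp (-(r * t))) =
      ENNReal.ofReal ((1 / r) ^ a * Real.Gamma a) := by
  have h := Real.integral_rpow_mul_exp_neg_mul_Ioi ha hr
  rw [← ofReal_integral_eq_lintegral_ofReal (.of_integral_ne_zero (by rw [h]; positivity)) ?_, h]
  filter_upwards [ae_restrict_mem measurableSet_Ioi] with t (ht : 0 < t)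
  change 0 ≤ _
  positivity

/-- The Laplace transform of the squared modulus of a standard complex Gaussian variable. -/
lemma complexGaussian_laplace (s : ℝ≥0∞) :
    ∫⁻ z, expNeg (s * ‖z‖ₑ ^ 2) ∂complexGaussian = (1 + s)⁻¹ := by
  rw [lintegral_complexGaussian (F := fun x => expNeg (s * x))
    (measurable_expNeg.comp (measurable_const.mul measurable_id))]
  induction s with
  | top =>
    simp only [add_top, ENNReal.inv_top]
    rw [setLIntegral_congr_fun (g := fun _ => 0) measurableSet_Ioi, lintegral_zero]
    intro x hx
    simp only
    rw [ENNReal.top_mul (by simpa using hx), expNeg_top, mul_zero]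
  | coe s =>
    have h := lintegral_rpow_mul_exp_neg_mul_Ioi (a := 1) (r := 1 + s) one_pos (by positivity)
    simp only [sub_self, Real.rpow_zero, one_mul, Real.rpow_one, Real.Gamma_one, mul_one] at h
    have h2 : ENNReal.ofReal (1 / (1 + s)) = (1 + (s : ℝ≥0∞))⁻¹ := by
      rw [one_div, ENNReal.ofReal_inv_of_pos (by positivity),
        ENNReal.ofReal_add (by positivity) (by positivity)]
      simp
    rw [← h2, ← h]
    refine setLIntegral_congr_fun measurableSet_Ioi fun x hx => ?_
    have hx : 0 < x := hx
    rw [← ENNReal.ofReal_coe_nnreal, ← ENNReal.ofReal_mul (by positivity),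
      expNeg_ofReal (by positivity), ← ENNReal.ofReal_mul (by positivity), ← Real.exp_add]
    congr 2; ring

/-! ### Radial integrals in the plane -/

lemma lintegral_exp_neg_mul_norm_rpow {α b : ℝ} (hα : 0 < α) (hb : 0 < b) :
    ∫⁻ y : Plane, ENNReal.ofReal (Real.exp (-(b * ‖y‖ ^ α))) =
      ENNReal.ofReal (2 * Real.pi / α * Real.Gamma (2 / α) * b ^ (-(2 / α))) := by
  have h := integral_fun_norm_addHaar (volume : Measure Plane) fun r => Real.exp (-(b * r ^ α))
  have hball : volume.real (Metric.ball (0 : Plane) 1) = Real.pi := by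
    rw [measureReal_def, EuclideanSpace.volume_ball_fin_two]
    simp [Real.pi_pos.le]
  have hrad : ∫ y in Set.Ioi (0 : ℝ), y ^ (2 - 1) * Real.exp (-(b * y ^ α)) =
      b ^ (-(2 / α)) * (1 / α) * Real.Gamma (2 / α) := by
    have := integral_rpow_mul_exp_neg_mul_rpow (q := 1) hα (by norm_num) hb
    have h2 : (1 : ℝ) + 1 = 2 := by norm_num
    rw [h2] at this
    simpa [neg_div] using this
  rw [finrank_euclideanSpace_fin, hball] at h
  simp only [smul_eq_mul] at h
  rw [hrad] at h
  have h0 : ∫ y : Plane, Real.exp (-(b * ‖y‖ ^ α)) =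
      2 * Real.pi / α * Real.Gamma (2 / α) * b ^ (-(2 / α)) := by
    rw [h]; simp only [nsmul_eq_mul]; push_cast; ring
  rw [← ofReal_integral_eq_lintegral_ofReal (.of_integral_ne_zero (by rw [h0]; positivity))
    (ae_of_all _ fun y => (Real.exp_pos _).le), h0]

lemma lintegral_one_add_norm_rpow_neg {α β s : ℝ} (hα : 0 < α) (hβ : 0 < β) (hs : 2 / α < s) :
    ∫⁻ y : Plane, ENNReal.ofReal ((1 + ‖y‖ ^ α / β) ^ (-s)) =
      ENNReal.ofReal (2 * Real.pi / α * Real.Gamma (2 / α) * Real.Gamma (s - 2 / α) /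
        Real.Gamma s * β ^ (2 / α)) := by
  have h2α : 0 < 2 / α := by positivity
  have hs0 : 0 < s := h2α.trans hs
  have h1 : ∀ y : Plane, ENNReal.ofReal ((1 + ‖y‖ ^ α / β) ^ (-s)) =
      ENNReal.ofReal (Real.Gamma s)⁻¹ * ∫⁻ t in Set.Ioi (0 : ℝ),
        ENNReal.ofReal (t ^ (s - 1) * Real.exp (-((1 + ‖y‖ ^ α / β) * t))) := by
    intro y
    rw [lintegral_rpow_mul_exp_neg_mul_Ioi hs0 (by positivity), ← ENNReal.ofReal_mul (by positivity)]
    congr 1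
    rw [one_div, Real.inv_rpow (by positivity), Real.rpow_neg (by positivity)]
    field_simp
  simp_rw [h1]
  rw [lintegral_const_mul _ (Measurable.lintegral_prod_right (by fun_prop)),
    lintegral_lintegral_swap (by fun_prop)]
  have h3 : ∀ t ∈ Set.Ioi (0 : ℝ), ∫⁻ y : Plane,
      ENNReal.ofReal (t ^ (s - 1) * Real.exp (-((1 + ‖y‖ ^ α / β) * t))) =
      ENNReal.ofReal (2 * Real.pi / α * Real.Gamma (2 / α) * β ^ (2 / α)) *
        ENNReal.ofReal (t ^ (s - 2 / α - 1) * Real.exp (-(1 * t))) := by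
    intro t ht
    have ht : 0 < t := ht
    have h4 : ∀ y : Plane, ENNReal.ofReal (t ^ (s - 1) * Real.exp (-((1 + ‖y‖ ^ α / β) * t))) =
        ENNReal.ofReal (t ^ (s - 1) * Real.exp (-t)) *
          ENNReal.ofReal (Real.exp (-(t / β * ‖y‖ ^ α))) := by
      intro y
      rw [← ENNReal.ofReal_mul (by positivity), mul_assoc, ← Real.exp_add]
      congr 3; field_simp; ring
    simp_rw [h4]
    rw [lintegral_const_mul _ (by fun_prop),
      lintegral_exp_neg_mul_norm_rpow hα (by positivity), ← ENNReal.ofReal_mul (by positivity),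
      ← ENNReal.ofReal_mul (by positivity)]
    congr 1
    rw [Real.div_rpow ht.le hβ.le, Real.rpow_neg hβ.le, one_mul, div_inv_eq_mul,
      show s - 2 / α - 1 = (s - 1) + -(2 / α) by ring, Real.rpow_add ht]
    ring
  rw [setLIntegral_congr_fun measurableSet_Ioi h3, lintegral_const_mul _ (by fun_prop),
    lintegral_rpow_mul_exp_neg_mul_Ioi (by linarith) one_pos,
    ← ENNReal.ofReal_mul (by positivity), ← ENNReal.ofReal_mul (by positivity)]
  congr 1
  simp only [div_one, Real.one_rpow, one_mul]
  ring

/-! ### The fading factor -/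

/-- The Laplace transform at `β` of the interference of a node at `z`: the probability that this
interference alone does not cause an outage. -/
def fade (α β : ℝ) (z : Plane) : ℝ≥0∞ := (1 + ENNReal.ofReal β * ‖z‖ₑ ^ (-α))⁻¹

lemma fade_le_one (α β : ℝ) (z : Plane) : fade α β z ≤ 1 :=
  ENNReal.inv_le_one.2 le_self_add

lemma continuous_fade (α β : ℝ) : Continuous (fade α β) := by
  have h : Continuous fun z : Plane => ENNReal.ofReal β * ‖z‖ₑ ^ (-α) := (ENNReal.continuous_const_mul ENNReal.ofReal_ne_top).comp
    (ENNReal.continuous_rpow_const.comp continuous_enorm)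
  exact (continuous_const.add h).inv

lemma fade_eq_ofReal {α β : ℝ} (hα : 0 < α) (hβ : 0 < β) (z : Plane) :
    fade α β z = ENNReal.ofReal (1 - (1 + ‖z‖ ^ α / β) ^ (-1 : ℝ)) := by
  rw [Real.rpow_neg_one, fade]
  rcases eq_or_ne z 0 with rfl | hz
  · simp [Real.zero_rpow hα.ne', ENNReal.zero_rpow_of_neg (neg_lt_zero.2 hα), ENNReal.mul_top, hβ]
  · have hz' : 0 < ‖z‖ := norm_pos_iff.2 hz
    rw [← ofReal_norm, ENNReal.ofReal_rpow_of_pos hz', ← ENNReal.ofReal_mul hβ.le,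
      ← ENNReal.ofReal_one, ← ENNReal.ofReal_add zero_le_one (by positivity),
      ← ENNReal.ofReal_inv_of_pos (by positivity), Real.rpow_neg hz'.le]
    congr 1
    field_simp
    ring

lemma one_sub_fade {α β : ℝ} (hα : 0 < α) (hβ : 0 < β) (z : Plane) :
    1 - fade α β z = ENNReal.ofReal ((1 + ‖z‖ ^ α / β) ^ (-1 : ℝ)) := by
  have h : (1 + ‖z‖ ^ α / β) ^ (-1 : ℝ) ≤ 1 := by
    rw [Real.rpow_neg_one]
    exact inv_le_one_of_one_le₀ (le_add_of_nonneg_right (by positivity))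
  rw [fade_eq_ofReal hα hβ, ← ENNReal.ofReal_one, ← ENNReal.ofReal_sub _ (by linarith)]
  congr 1; ring

/-- The constant `c₁` as a function of the path-loss exponent. -/
def radialConst (α : ℝ) : ℝ := 2 * Real.pi ^ 2 * (Real.sin (2 * Real.pi / α))⁻¹ / α

lemma gamma_mul_gamma {α : ℝ} :
    2 * Real.pi / α * Real.Gamma (2 / α) * Real.Gamma (1 - 2 / α) = radialConst α := by
  rw [mul_assoc, Real.Gamma_mul_Gamma_one_sub, radialConst,
    show Real.pi * (2 / α) = 2 * Real.pi / α by ring]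
  ring

lemma radialConst_pos {α : ℝ} (hα : 2 < α) : 0 < radialConst α := by
  have h : 2 / α < 1 := (div_lt_one (by linarith)).2 hα
  rw [← gamma_mul_gamma]
  have := Real.Gamma_pos_of_pos (show 0 < 2 / α by positivity)
  have := Real.Gamma_pos_of_pos (show 0 < 1 - 2 / α by linarith)
  have := Real.pi_pos
  positivity

lemma lintegral_one_sub_fade {α β : ℝ} (hα : 2 < α) (hβ : 0 < β) :
    ∫⁻ z, (1 - fade α β z) = ENNReal.ofReal (radialConst α * β ^ (2 / α)) := by
  have h : 2 / α < 1 := (div_lt_one (by linarith)).2 hα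
  simp_rw [one_sub_fade (show 0 < α by linarith) hβ]
  rw [lintegral_one_add_norm_rpow_neg (by linarith) hβ h, Real.Gamma_one, gamma_mul_gamma, div_one]

lemma lintegral_one_sub_fade_sq {α β : ℝ} (hα : 2 < α) (hβ : 0 < β) :
    ∫⁻ z, (1 - fade α β z ^ 2) =
      ENNReal.ofReal (radialConst α * (1 + 2 / α) * β ^ (2 / α)) := by
  have hα0 : 0 < α := by linarith
  have h : 2 / α < 1 := (div_lt_one (by linarith)).2 hα
  have hC := radialConst_pos hα
  have h0 : 0 < 2 / α := by positivity
  have hg2 : ∫⁻ y : Plane, ENNReal.ofReal ((1 + ‖y‖ ^ α / β) ^ (-2 : ℝ)) =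
      ENNReal.ofReal (radialConst α * (1 - 2 / α) * β ^ (2 / α)) := by
    rw [lintegral_one_add_norm_rpow_neg hα0 hβ (by linarith), Real.Gamma_two,
      show 2 - 2 / α = (1 - 2 / α) + 1 by ring, Real.Gamma_add_one (by linarith), ← gamma_mul_gamma]
    congr 1; ring
  have hsum : (∫⁻ z, (1 - fade α β z ^ 2)) +
      ∫⁻ y : Plane, ENNReal.ofReal ((1 + ‖y‖ ^ α / β) ^ (-2 : ℝ)) =
      2 * ∫⁻ z, (1 - fade α β z) := by
    have hm : Measurable fun z => 1 - fade α β z :=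
      measurable_const.sub (continuous_fade α β).measurable
    rw [← lintegral_add_right _ (by fun_prop), ← lintegral_const_mul _ hm]
    refine lintegral_congr fun z => ?_
    have hg : 0 < (1 + ‖z‖ ^ α / β) ^ (-1 : ℝ) := by positivity
    have hg1 : (1 + ‖z‖ ^ α / β) ^ (-1 : ℝ) ≤ 1 := by
      rw [Real.rpow_neg_one]
      exact inv_le_one_of_one_le₀ (le_add_of_nonneg_right (by positivity))
    have hpow : (1 + ‖z‖ ^ α / β) ^ (-2 : ℝ) = ((1 + ‖z‖ ^ α / β) ^ (-1 : ℝ)) ^ 2 := by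
      rw [← Real.rpow_natCast, ← Real.rpow_mul (by positivity)]; norm_num
    rw [one_sub_fade hα0 hβ, fade_eq_ofReal hα0 hβ, hpow]
    generalize (1 + ‖z‖ ^ α / β) ^ (-1 : ℝ) = g at *
    rw [← ENNReal.ofReal_pow (by linarith), ← ENNReal.ofReal_one,
      ← ENNReal.ofReal_sub _ (by positivity),
      ← ENNReal.ofReal_add (by nlinarith) (by positivity), ← ENNReal.ofReal_ofNat,
      ← ENNReal.ofReal_mul (by norm_num)]
    congr 1; ring
  rw [hg2, lintegral_one_sub_fade hα hβ] at hsum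
  refine (ENNReal.add_left_inj (ENNReal.ofReal_ne_top (r := radialConst α * (1 - 2 / α) *
    β ^ (2 / α)))).1 (hsum.trans ?_)
  have h1 : 0 < 1 - 2 / α := by linarith
  rw [← ENNReal.ofReal_ofNat, ← ENNReal.ofReal_mul (by norm_num),
    ← ENNReal.ofReal_add (by positivity) (by positivity)]
  congr 1; ring

/-! ### Integration against independent variables -/

lemma lintegral_of_indepFun {Ω A B : Type*} [MeasurableSpace Ω] [MeasurableSpace A]
    [MeasurableSpace B] {P : Measure Ω} [IsProbabilityMeasure P] {X : Ω → A} {Y : Ω → B}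
    (hX : Measurable X) (hY : Measurable Y) (h : IndepFun X Y P) {F : A → B → ℝ≥0∞}
    (hF : Measurable (Function.uncurry F)) :
    ∫⁻ ω, F (X ω) (Y ω) ∂P = ∫⁻ ω, ∫⁻ b, F (X ω) b ∂(P.map Y) ∂P := by
  calc ∫⁻ ω, F (X ω) (Y ω) ∂P
      = ∫⁻ z, Function.uncurry F z ∂(P.map fun ω => (X ω, Y ω)) := by
        rw [lintegral_map hF (hX.prodMk hY)]; rfl
    _ = ∫⁻ a, ∫⁻ b, F a b ∂(P.map Y) ∂(P.map X) := by
        rw [h.map_prod_eq_prod_map_map hX.aemeasurable hY.aemeasurable,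
          lintegral_prod _ hF.aemeasurable]; rfl
    _ = _ := by
        rw [lintegral_map _ hX]
        exact hF.lintegral_prod_right

/-- Integrating out the channel gain of the direct link. -/
lemma lintegral_indicator_lt_enorm_sq {Ω : Type*} [MeasurableSpace Ω] {P : Measure Ω}
    [IsProbabilityMeasure P] {X : Ω → ℂ} {G Y : Ω → ℝ≥0∞} (hX : Measurable X) (hG : Measurable G)
    (hY : Measurable Y) (hlaw : P.map X = complexGaussian)
    (h : IndepFun (fun ω => (G ω, Y ω)) X P) :
    ∫⁻ ω, G ω * {ω | Y ω < ‖X ω‖ₑ ^ 2}.indicator 1 ω ∂P = ∫⁻ ω, G ω * expNeg (Y ω) ∂P := by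
  have hS : MeasurableSet {z : (ℝ≥0∞ × ℝ≥0∞) × ℂ | z.1.2 < ‖z.2‖ₑ ^ 2} :=
    measurableSet_lt (by fun_prop) (by fun_prop)
  have hF : Measurable (Function.uncurry fun (a : ℝ≥0∞ × ℝ≥0∞) (z : ℂ) =>
      a.1 * {z : (ℝ≥0∞ × ℝ≥0∞) × ℂ | z.1.2 < ‖z.2‖ₑ ^ 2}.indicator 1 (a, z)) :=
    (measurable_fst.comp measurable_fst).mul
      ((measurable_const (a := (1 : ℝ≥0∞))).indicator hS)
  refine (lintegral_of_indepFun (hG.prodMk hY) hX h hF).trans ?_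
  refine lintegral_congr fun ω => ?_
  have hm : Measurable fun z : ℂ => {z : (ℝ≥0∞ × ℝ≥0∞) × ℂ | z.1.2 < ‖z.2‖ₑ ^ 2}.indicator
      (1 : (ℝ≥0∞ × ℝ≥0∞) × ℂ → ℝ≥0∞) ((G ω, Y ω), z) :=
    ((measurable_const (a := (1 : ℝ≥0∞))).indicator hS).comp measurable_prodMk_left
  rw [lintegral_const_mul _ hm, hlaw, ← complexGaussian_tail,
    ← lintegral_indicator_one (measurableSet_lt (by fun_prop) (by fun_prop))]
  rfl

/-! ### Independence of the sources of randomness -/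

/-- The uniform law on the directions. -/
def angleLaw : Measure ℝ := ProbabilityTheory.cond volume (Set.Ico 0 (2 * Real.pi))

instance : IsProbabilityMeasure angleLaw :=
  cond_isProbabilityMeasure_of_finite (by simp [Real.pi_pos])
    (by rw [Real.volume_Ico]; exact ENNReal.ofReal_ne_top)

/-- The unit vector with the given angle. -/
def dir (θ : ℝ) : Plane := !₂[Real.cos θ, Real.sin θ]

lemma continuous_dir : Continuous dir := by
  unfold dir
  refine (PiLp.continuous_toLp 2 _).comp (continuous_pi fun i => ?_)
  fin_cases i
  · exact Real.continuous_cos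
  · exact Real.continuous_sin

namespace Network

variable {Ω : Type*} [MeasurableSpace Ω] {P : Measure Ω} {lam : ℝ} (N : Network P lam)

/-- The `σ`-algebra generated by a source of randomness. -/
@[reducible] def source : Source → MeasurableSpace Ω
  | .positions => ⨆ n, MeasurableSpace.comap (N.T n) inferInstance
  | .direction n => MeasurableSpace.comap (N.angle n) inferInstance
  | .access n => MeasurableSpace.comap (N.active n) inferInstance
  | .forward m n => MeasurableSpace.comap (N.h m n) inferInstance
  | .reverse m n => MeasurableSpace.comap (N.g m n) inferInstance

/-- The `σ`-algebra generated by a set of sources of randomness. -/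
@[reducible] def block (S : Set Source) : MeasurableSpace Ω := ⨆ s ∈ S, N.source s

lemma source_le (s : Source) : N.source s ≤ ‹MeasurableSpace Ω› := by
  cases s with
  | positions => exact iSup_le fun n => (N.ppp_T.1 n).comap_le
  | direction n => exact (N.measurable_angle n).comap_le
  | access n => exact (N.measurable_active n).comap_le
  | forward m n => exact (N.measurable_h m n).comap_le
  | reverse m n => exact (N.measurable_g m n).comap_le

lemma block_le (S : Set Source) : N.block S ≤ ‹MeasurableSpace Ω› :=
  iSup₂_le fun s _ => N.source_le s

lemma iIndep_source : iIndep N.source P := N.indep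

lemma indep_block {S S' : Set Source} (h : Disjoint S S') : Indep (N.block S) (N.block S') P :=
  indep_iSup_of_disjoint N.source_le N.iIndep_source h

lemma indepFun_block {A B : Type*} [MeasurableSpace A] [MeasurableSpace B] {X : Ω → A} {Y : Ω → B}
    {S S' : Set Source} (h : Disjoint S S') (hX : Measurable[N.block S] X)
    (hY : Measurable[N.block S'] Y) : IndepFun X Y P :=
  indep_of_indep_of_le_left (indep_of_indep_of_le_right (N.indep_block h) hY.comap_le) hX.comap_le

lemma lintegral_mul_block {f g : Ω → ℝ≥0∞} {S S' : Set Source} (h : Disjoint S S')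
    (hf : Measurable[N.block S] f) (hg : Measurable[N.block S'] g) :
    ∫⁻ ω, f ω * g ω ∂P = (∫⁻ ω, f ω ∂P) * ∫⁻ ω, g ω ∂P :=
  lintegral_mul_eq_lintegral_mul_lintegral_of_independent_measurableSpace (N.block_le S)
    (N.block_le S') (N.indep_block h) hf hg

lemma source_le_block {S : Set Source} {s : Source} (hs : s ∈ S) : N.source s ≤ N.block S :=
  le_iSup₂ (f := fun s (_ : s ∈ S) => N.source s) s hs

lemma block_mono {S S' : Set Source} (h : S ⊆ S') : N.block S ≤ N.block S' :=
  iSup₂_le fun _ hs => N.source_le_block (h hs)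

lemma measurable_block_T {S : Set Source} (hs : Source.positions ∈ S) (n : ℕ) :
    Measurable[N.block S] (N.T n) :=
  (comap_measurable (N.T n)).mono ((le_iSup (fun n => MeasurableSpace.comap (N.T n) _) n).trans
    (N.source_le_block hs)) le_rfl

lemma measurable_block_angle {S : Set Source} {n : ℕ} (hs : Source.direction n ∈ S) :
    Measurable[N.block S] (N.angle n) :=
  (comap_measurable (N.angle n)).mono (N.source_le_block hs) le_rfl

lemma measurable_block_active {S : Set Source} {n : ℕ} (hs : Source.access n ∈ S) :
    Measurable[N.block S] (N.active n) :=
  (comap_measurable (N.active n)).mono (N.source_le_block hs) le_rfl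

lemma measurable_block_h {S : Set Source} {m n : ℕ} (hs : Source.forward m n ∈ S) :
    Measurable[N.block S] (N.h m n) :=
  (comap_measurable (N.h m n)).mono (N.source_le_block hs) le_rfl

lemma measurable_block_g {S : Set Source} {m n : ℕ} (hs : Source.reverse m n ∈ S) :
    Measurable[N.block S] (N.g m n) :=
  (comap_measurable (N.g m n)).mono (N.source_le_block hs) le_rfl

lemma map_angle (n : ℕ) : P.map (N.angle n) = angleLaw := N.uniform_angle n

end Network

/-! ### The contribution of one interfering pair -/

/-- The law of a mark: direction, activity and the two channels. -/
abbrev Mark : Type := ℝ × Bool × ℂ × ℂ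

/-- The conditional probability that, given its mark, an interfering pair with transmitter at `y`
does not cause an outage of the pair with transmitter at `x` and direction `θ`. -/
def markFactor (q : Params) (x : Plane) (θ : ℝ) (y : Plane) (M : Mark) : ℝ≥0∞ :=
  if M.2.1 = true then
    expNeg (ENNReal.ofReal q.β₁ * (‖y - x - q.d • dir θ‖ₑ ^ (-q.α) * ‖M.2.2.1‖ₑ ^ 2)) *
    expNeg (ENNReal.ofReal q.β₂ * (‖y + q.d • dir M.1 - x‖ₑ ^ (-q.α) * ‖M.2.2.2‖ₑ ^ 2))
  else 1

/-- The expectation of `markFactor` for an active interfering pair. -/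
def activeFactor (q : Params) (θ : ℝ) (z : Plane) : ℝ≥0∞ :=
  fade q.α q.β₁ (z - q.d • dir θ) * ∫⁻ θ', fade q.α q.β₂ (z + q.d • dir θ') ∂angleLaw

/-- The expectation of `markFactor` for an interfering pair with access probability `a`. -/
def pairFactor (q : Params) (a : ℝ) (θ : ℝ) (x y : Plane) : ℝ≥0∞ :=
  ENNReal.ofReal (1 - a) + ENNReal.ofReal a * activeFactor q θ (y - x)

lemma markFactor_le_one (q : Params) (x : Plane) (θ : ℝ) (y : Plane) (M : Mark) :
    markFactor q x θ y M ≤ 1 := by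
  unfold markFactor
  split_ifs
  · exact mul_le_one' (expNeg_le_one _) (expNeg_le_one _)
  · exact le_rfl

lemma measurable_markFactor (q : Params) :
    Measurable fun z : (Plane × ℝ × Plane) × Mark =>
      markFactor q z.1.1 z.1.2.1 z.1.2.2 z.2 := by
  have hd := continuous_dir.measurable
  refine Measurable.ite ?_ (Measurable.mul (measurable_expNeg.comp ?_)
    (measurable_expNeg.comp ?_)) measurable_const
  · exact (measurableSet_singleton true).preimage (f := fun z : (Plane × ℝ × Plane) × Mark => z.2.2.1)
      (by fun_prop)
  · fun_prop
  · fun_prop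

lemma activeFactor_le_one (q : Params) (θ : ℝ) (z : Plane) : activeFactor q θ z ≤ 1 := by
  refine mul_le_one' (fade_le_one _ _ _) ?_
  calc ∫⁻ θ', fade q.α q.β₂ (z + q.d • dir θ') ∂angleLaw ≤ ∫⁻ _, 1 ∂angleLaw :=
        lintegral_mono fun θ' => fade_le_one _ _ _
    _ = 1 := by simp

lemma continuous_activeFactor (q : Params) : Continuous (Function.uncurry (activeFactor q)) := by
  have hd := continuous_dir
  have h1 : Continuous fun z : ℝ × Plane => fade q.α q.β₁ (z.2 - q.d • dir z.1) :=
    (continuous_fade _ _).comp (by fun_prop)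
  have h2 : Continuous fun z : Plane => ∫⁻ θ', fade q.α q.β₂ (z + q.d • dir θ') ∂angleLaw := by
    refine continuous_iff_continuousAt.2 fun z => ?_
    refine tendsto_lintegral_filter_of_dominated_convergence (fun _ => 1)
      (Eventually.of_forall fun w => ?_) (Eventually.of_forall fun w => ae_of_all _ fun θ' =>
        fade_le_one _ _ _) (by simp) (ae_of_all _ fun θ' => ?_)
    · exact ((continuous_fade _ _).comp (by fun_prop)).measurable
    · exact ((continuous_fade _ _).comp (by fun_prop)).tendsto z
  have hle : ∀ z : Plane, ∫⁻ θ', fade q.α q.β₂ (z + q.d • dir θ') ∂angleLaw ≤ 1 := fun z =>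
    (lintegral_mono fun θ' => fade_le_one _ _ _).trans_eq (by simp)
  refine continuous_iff_continuousAt.2 fun z => ?_
  exact ENNReal.Tendsto.mul (h1.tendsto z)
    (Or.inr ((hle _).trans_lt ENNReal.one_lt_top).ne) ((h2.comp continuous_snd).tendsto z)
    (Or.inr ((fade_le_one _ _ _).trans_lt ENNReal.one_lt_top).ne)

lemma pairFactor_le_one (q : Params) {a : ℝ} (ha : 0 ≤ a) (ha1 : a ≤ 1) (θ : ℝ) (x y : Plane) :
    pairFactor q a θ x y ≤ 1 := by
  calc pairFactor q a θ x y ≤ ENNReal.ofReal (1 - a) + ENNReal.ofReal a * 1 := by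
        unfold pairFactor; gcongr; exact activeFactor_le_one _ _ _
    _ = 1 := by
        rw [mul_one, ← ENNReal.ofReal_add (by linarith) ha]; simp

lemma continuous_pairFactor (q : Params) (a : ℝ) :
    Continuous fun z : ℝ × Plane × Plane => pairFactor q a z.1 z.2.1 z.2.2 := by
  refine continuous_const.add ((ENNReal.continuous_const_mul ENNReal.ofReal_ne_top).comp ?_)
  exact (continuous_activeFactor q).comp
    (f := fun z : ℝ × Plane × Plane => (z.1, z.2.2 - z.2.1)) (by fun_prop)

lemma one_sub_pairFactor (q : Params) {a : ℝ} (ha : 0 ≤ a) (ha1 : a ≤ 1) (θ : ℝ) (x y : Plane) :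
    1 - pairFactor q a θ x y = ENNReal.ofReal a * (1 - activeFactor q θ (y - x)) := by
  have h : (1 : ℝ≥0∞) = ENNReal.ofReal (1 - a) + ENNReal.ofReal a := by
    rw [← ENNReal.ofReal_add (by linarith) ha]; simp
  rw [pairFactor, ENNReal.mul_sub (fun _ _ => ENNReal.ofReal_ne_top), mul_one]
  nth_rw 1 [h]
  rw [ENNReal.add_sub_add_eq_sub_left ENNReal.ofReal_ne_top]

namespace Network

variable {Ω : Type*} [MeasurableSpace Ω] {P : Measure Ω} {lam : ℝ} (N : Network P lam)

/-- The mark of the pair `n`, as seen from the pair `m`. -/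
def mark (m n : ℕ) (ω : Ω) : Mark := (N.angle n ω, N.active n ω, N.h m n ω, N.g m n ω)

/-- The sources of the mark of the pair `n`, as seen from the pair `m`. -/
def markSources (m n : ℕ) : Set Source :=
  {.direction n, .access n, .forward m n, .reverse m n}

lemma measurable_block_mark {S : Set Source} {m n : ℕ} (h : markSources m n ⊆ S) :
    Measurable[N.block S] (N.mark m n) := by
  refine Measurable.prodMk (N.measurable_block_angle (h ?_)) (Measurable.prodMk
    (N.measurable_block_active (h ?_)) (Measurable.prodMk (N.measurable_block_h (h ?_))
    (N.measurable_block_g (h ?_)))) <;> simp [markSources]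

lemma measurable_mark (m n : ℕ) : Measurable (N.mark m n) :=
  (N.measurable_block_mark (Set.subset_univ _)).mono (N.block_le Set.univ) le_rfl

variable [IsProbabilityMeasure P]

lemma prob_active_eq (n : ℕ) : P {ω | N.active n ω = true} = ENNReal.ofReal N.accessProb := by
  rw [← N.prob_active n, ofReal_measureReal]

lemma lintegral_active (n : ℕ) (a b : ℝ≥0∞) :
    ∫⁻ ω, (if N.active n ω = true then a else b) ∂P =
      a * ENNReal.ofReal N.accessProb + b * ENNReal.ofReal (1 - N.accessProb) := by
  classical
  have hact : MeasurableSet {ω | N.active n ω = true} :=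
    N.measurable_active n (measurableSet_singleton true)
  rw [ENNReal.ofReal_sub _ N.accessProb_pos.le, ← N.prob_active_eq n, ENNReal.ofReal_one,
    ← prob_compl_eq_one_sub hact, ← lintegral_indicator_one hact,
    ← lintegral_indicator_one hact.compl, ← lintegral_const_mul _
      (measurable_one.indicator hact), ← lintegral_const_mul _
      (measurable_one.indicator hact.compl), ← lintegral_add_left
      ((measurable_one.indicator hact).const_mul _)]
  congr 1
  funext ω
  by_cases h : N.active n ω = true <;> simp [h]

lemma lintegral_active_mul (m n : ℕ) {E₁ : ℂ → ℝ≥0∞} {E₂ : ℝ → ℂ → ℝ≥0∞} (hE₁ : Measurable E₁)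
    (hE₂ : Measurable (Function.uncurry E₂)) :
    ∫⁻ ω, (if N.active n ω = true then E₁ (N.h m n ω) * E₂ (N.angle n ω) (N.g m n ω) else 1) ∂P =
      ENNReal.ofReal (1 - N.accessProb) + ENNReal.ofReal N.accessProb *
        ((∫⁻ h, E₁ h ∂complexGaussian) * ∫⁻ θ, ∫⁻ g, E₂ θ g ∂complexGaussian ∂angleLaw) := by
  have hsingle : Measurable fun b : Bool => if b = true then (1 : ℝ≥0∞) else 0 :=
    measurable_of_countable _
  have hsplit : ∀ ω, (if N.active n ω = true then
      E₁ (N.h m n ω) * E₂ (N.angle n ω) (N.g m n ω) else 1) =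
      (if N.active n ω = true then 0 else 1) + (if N.active n ω = true then 1 else 0) *
        (E₁ (N.h m n ω) * E₂ (N.angle n ω) (N.g m n ω)) := by
    intro ω
    by_cases h : N.active n ω = true <;> simp [h]
  have h1 := N.lintegral_active n 1 0
  have h0 := N.lintegral_active n 0 1
  simp only [one_mul, zero_mul, add_zero, zero_add] at h1 h0
  have hb1 : Measurable[N.block {.forward m n}] fun ω => E₁ (N.h m n ω) :=
    hE₁.comp (N.measurable_block_h (Set.mem_singleton _))
  have hb2 : Measurable[N.block {.direction n, .reverse m n}]
      fun ω => E₂ (N.angle n ω) (N.g m n ω) :=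
    hE₂.comp ((N.measurable_block_angle (by simp)).prodMk (N.measurable_block_g (by simp)))
  have hb3 : Measurable[N.block {.forward m n, .direction n, .reverse m n}]
      fun ω => E₁ (N.h m n ω) * E₂ (N.angle n ω) (N.g m n ω) :=
    (hb1.mono (N.block_mono (by simp)) le_rfl).mul
      (hb2.mono (N.block_mono (by simp)) le_rfl)
  have hb4 : Measurable[N.block {.access n}]
      fun ω => if N.active n ω = true then (1 : ℝ≥0∞) else 0 :=
    hsingle.comp (N.measurable_block_active (Set.mem_singleton _))
  have hb5 : Measurable fun ω => (if N.active n ω = true then (1 : ℝ≥0∞) else 0) *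
      (E₁ (N.h m n ω) * E₂ (N.angle n ω) (N.g m n ω)) :=
    (hb4.mono (N.block_le _) le_rfl).mul (hb3.mono (N.block_le _) le_rfl)
  simp_rw [hsplit]
  rw [lintegral_add_right _ hb5,
    h0, N.lintegral_mul_block (by simp) hb4 hb3, h1, N.lintegral_mul_block (by simp) hb1 hb2,
    lintegral_of_indepFun (N.measurable_angle n) (N.measurable_g m n)
      (N.indepFun_block (S := {.direction n}) (S' := {.reverse m n}) (by simp)
        (N.measurable_block_angle (Set.mem_singleton _))
        (N.measurable_block_g (Set.mem_singleton _))) hE₂, N.law_g,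
    ← lintegral_map hE₁ (N.measurable_h m n), N.law_h, ← N.map_angle n,
    lintegral_map _ (N.measurable_angle n)]
  exact hE₂.lintegral_prod_right

lemma lintegral_markFactor (q : Params) (x : Plane) (θ : ℝ) (y : Plane) (m n : ℕ) :
    ∫⁻ ω, markFactor q x θ y (N.mark m n ω) ∂P = pairFactor q N.accessProb θ x y := by
  have hd := continuous_dir.measurable
  refine (N.lintegral_active_mul m n
    (E₁ := fun h => expNeg (ENNReal.ofReal q.β₁ *
      (‖y - x - q.d • dir θ‖ₑ ^ (-q.α) * ‖h‖ₑ ^ 2)))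
    (E₂ := fun θ' g => expNeg (ENNReal.ofReal q.β₂ *
      (‖y + q.d • dir θ' - x‖ₑ ^ (-q.α) * ‖g‖ₑ ^ 2)))
    (measurable_expNeg.comp (by fun_prop)) (measurable_expNeg.comp (by fun_prop))).trans ?_
  simp only [← mul_assoc, complexGaussian_laplace]
  have h : ∀ θ', y + q.d • dir θ' - x = y - x + q.d • dir θ' := fun θ' => by abel
  simp only [pairFactor, activeFactor, fade, h, mul_assoc]

end Network

/-! ### The success event -/

lemma lt_mutualInfo_iff {F B : ℝ} (hF : 0 < F) (hB : 0 < B) (sir : ℝ≥0∞) :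
    (B : EReal) < mutualInfo F sir ↔ ENNReal.ofReal ((2 : ℝ) ^ (B / F) - 1) < sir := by
  have hlog : 0 < Real.log 2 := Real.log_pos one_lt_two
  have hθ : (1 : ℝ) ≤ 2 ^ (B / F) := Real.one_le_rpow one_le_two (by positivity)
  rw [mutualInfo]
  induction sir with
  | top =>
    rw [add_top, ENNReal.log_top, EReal.coe_mul_top_of_pos (by positivity)]
    simp
  | coe x =>
    have h1 : (1 + (x : ℝ≥0∞)) = ENNReal.ofReal (1 + x) := by
      rw [ENNReal.ofReal_add zero_le_one x.coe_nonneg]; simp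
    have hx := x.coe_nonneg
    rw [h1, ENNReal.log_ofReal_of_pos (by positivity), ← EReal.coe_mul, EReal.coe_lt_coe_iff,
      ← ENNReal.ofReal_coe_nnreal, ENNReal.ofReal_lt_ofReal_iff_of_nonneg (by linarith),
      Real.rpow_def_of_pos two_pos, sub_lt_iff_lt_add', ← Real.lt_log_iff_exp_lt (by positivity),
      div_mul_eq_mul_div, lt_div_iff₀ hlog, mul_div_assoc', div_lt_iff₀ hF]
    rw [mul_comm B, mul_comm F]

lemma ofReal_lt_div_iff {d α θ : ℝ} (hd : 0 < d) (hθ : 0 < θ) {H I : ℝ≥0∞} :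
    ENNReal.ofReal θ < ENNReal.ofReal d ^ (-α) * H / I ↔ ENNReal.ofReal (d ^ α * θ) * I < H := by
  have hD : 0 < d ^ (-α) := by positivity
  rw [ENNReal.ofReal_rpow_of_pos hd]
  have hD0 : ENNReal.ofReal (d ^ (-α)) ≠ 0 := by simpa using hD
  have hβ : ENNReal.ofReal θ = ENNReal.ofReal (d ^ (-α)) * ENNReal.ofReal (d ^ α * θ) := by
    rw [← ENNReal.ofReal_mul hD.le, ← mul_assoc, ← Real.rpow_add hd]; simp
  rcases eq_or_ne I 0 with rfl | hI
  · rcases eq_or_ne H 0 with rfl | hH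
    · simp
    · rw [ENNReal.div_zero (mul_ne_zero hD0 hH), mul_zero]
      simp [pos_iff_ne_zero, hH]
  rcases eq_or_ne I ∞ with rfl | hI'
  · have : 0 < d ^ α * θ := by positivity
    rw [ENNReal.div_top, ENNReal.mul_top (by simpa using this)]
    simp
  · rw [ENNReal.lt_div_iff_mul_lt (Or.inl hI) (Or.inl hI'), hβ, mul_assoc,
      ENNReal.mul_lt_mul_iff_right hD0 ENNReal.ofReal_ne_top]

lemma measurable_ennreal_tsum {X : Type*} {mX : MeasurableSpace X} {f : ℕ → X → ℝ≥0∞}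
    (hf : ∀ n, Measurable (f n)) : Measurable fun x => ∑' n, f n x :=
  Measurable.tsum hf

namespace Network

variable {Ω : Type*} [MeasurableSpace Ω] {P : Measure Ω} {lam : ℝ} (N : Network P lam)

lemma expNeg_interference (q : Params) (m : ℕ) (ω : Ω) :
    expNeg (ENNReal.ofReal q.β₁ * N.interferenceTR q.α q.d m ω) *
      expNeg (ENNReal.ofReal q.β₂ * N.interferenceRT q.α q.d m ω) =
    infProd fun n => if n ≠ m then
      markFactor q (N.T m ω) (N.angle m ω) (N.T n ω) (N.mark m n ω) else 1 := by
  rw [interferenceTR, interferenceRT, ← ENNReal.tsum_mul_left, ← ENNReal.tsum_mul_left,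
    expNeg_tsum, expNeg_tsum, ← infProd_mul (fun _ => expNeg_le_one _) (fun _ => expNeg_le_one _)]
  congr 1
  funext n
  by_cases hn : n = m
  · simp [hn]
  by_cases ha : N.active n ω = true
  · have e1 : edist (N.T n ω) (N.R q.d m ω) =
        ‖N.T n ω - N.T m ω - q.d • dir (N.angle m ω)‖ₑ := by
      rw [edist_eq_enorm_sub, R, sub_sub]; rfl
    have e2 : edist (N.R q.d n ω) (N.T m ω) =
        ‖N.T n ω + q.d • dir (N.angle n ω) - N.T m ω‖ₑ := by
      rw [edist_eq_enorm_sub, R]; rfl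
    simp [hn, ha, markFactor, mark, e1, e2]
  · simp [hn, ha, markFactor, mark]

lemma success_iff {q : Params} (hd : 0 < q.d) (hFTR : 0 < q.FTR) (hFRT : q.FTR < q.Ftotal)
    (hBTR : 0 < q.BTR) (hBRT : 0 < q.BRT) (m : ℕ) (ω : Ω) :
    N.Success q m ω ↔
      ENNReal.ofReal q.β₁ * N.interferenceTR q.α q.d m ω < ‖N.h m m ω‖ₑ ^ 2 ∧
      ENNReal.ofReal q.β₂ * N.interferenceRT q.α q.d m ω < ‖N.g m m ω‖ₑ ^ 2 := by
  have hF : 0 < q.FRT := sub_pos.2 hFRT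
  have h1 : (1 : ℝ) < 2 ^ (q.BTR / q.FTR) := Real.one_lt_rpow one_lt_two (by positivity)
  have h2 : (1 : ℝ) < 2 ^ (q.BRT / q.FRT) := Real.one_lt_rpow one_lt_two (by positivity)
  rw [Success, lt_mutualInfo_iff hFTR hBTR, lt_mutualInfo_iff hF hBRT, sirTR, sirRT,
    ofReal_lt_div_iff hd (by linarith), ofReal_lt_div_iff hd (by linarith)]
  rfl

/-! ### Integrating out the channels -/

lemma measurable_block_R {S : Set Source} (hT : Source.positions ∈ S) (d : ℝ) {n : ℕ}
    (hn : Source.direction n ∈ S) : Measurable[N.block S] (N.R d n) := by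
  have hdir := continuous_dir.measurable.comp (N.measurable_block_angle hn)
  exact (N.measurable_block_T hT n).add (hdir.const_smul d)

lemma measurable_block_interferenceTR {S : Set Source} {m : ℕ} (hT : Source.positions ∈ S)
    (hdir : ∀ n, Source.direction n ∈ S) (hacc : ∀ n, Source.access n ∈ S)
    (hfwd : ∀ n ≠ m, Source.forward m n ∈ S) (α d : ℝ) :
    Measurable[N.block S] (N.interferenceTR α d m) := by
  refine measurable_ennreal_tsum fun n => ?_
  by_cases hn : n = m
  · simp only [hn, ne_eq, not_true_eq_false, false_and, if_false]
    exact measurable_const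
  · simp only [ne_eq, hn, not_false_eq_true, true_and]
    refine Measurable.ite (N.measurable_block_active (hacc n) (measurableSet_singleton true)) ?_
      measurable_const
    exact ((measurable_edist.comp ((N.measurable_block_T hT n).prodMk
      (N.measurable_block_R hT d (hdir m)))).pow_const _).mul
      ((measurable_enorm.comp (N.measurable_block_h (hfwd n hn))).pow_const 2)

lemma measurable_block_interferenceRT {S : Set Source} {m : ℕ} (hT : Source.positions ∈ S)
    (hdir : ∀ n, Source.direction n ∈ S) (hacc : ∀ n, Source.access n ∈ S)
    (hrev : ∀ n ≠ m, Source.reverse m n ∈ S) (α d : ℝ) :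
    Measurable[N.block S] (N.interferenceRT α d m) := by
  refine measurable_ennreal_tsum fun n => ?_
  by_cases hn : n = m
  · simp only [hn, ne_eq, not_true_eq_false, false_and, if_false]
    exact measurable_const
  · simp only [ne_eq, hn, not_false_eq_true, true_and]
    refine Measurable.ite (N.measurable_block_active (hacc n) (measurableSet_singleton true)) ?_
      measurable_const
    exact ((measurable_edist.comp ((N.measurable_block_R hT d (hdir n)).prodMk
      (N.measurable_block_T hT m))).pow_const _).mul
      ((measurable_enorm.comp (N.measurable_block_g (hrev n hn))).pow_const 2)

/-- The indicator that the pair `m` is active with transmitter in `Q`. -/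
def inSet (Q : Set Plane) (m : ℕ) (ω : Ω) : ℝ≥0∞ :=
  Q.indicator 1 (N.T m ω) * if N.active m ω = true then 1 else 0

lemma measurable_block_inSet {S : Set Source} {m : ℕ} {Q : Set Plane} (hQ : MeasurableSet Q)
    (hT : Source.positions ∈ S) (hacc : Source.access m ∈ S) :
    Measurable[N.block S] (N.inSet Q m) :=
  ((measurable_one.indicator hQ).comp (N.measurable_block_T hT m)).mul
    (Measurable.ite (N.measurable_block_active hacc (measurableSet_singleton true))
      measurable_const measurable_const)

lemma inSet_le_one (Q : Set Plane) (m : ℕ) (ω : Ω) : N.inSet Q m ω ≤ 1 := by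
  refine mul_le_one' (Set.indicator_le_self' (fun _ _ => zero_le) _) ?_
  split_ifs <;> simp

variable [IsProbabilityMeasure P]

lemma lintegral_direct_links (q : Params) {Q : Set Plane} (hQ : MeasurableSet Q) (m : ℕ) :
    ∫⁻ ω, N.inSet Q m ω *
      {ω | ENNReal.ofReal q.β₂ * N.interferenceRT q.α q.d m ω < ‖N.g m m ω‖ₑ ^ 2}.indicator 1 ω *
      {ω | ENNReal.ofReal q.β₁ * N.interferenceTR q.α q.d m ω < ‖N.h m m ω‖ₑ ^ 2}.indicator 1 ω ∂P =
    ∫⁻ ω, N.inSet Q m ω * expNeg (ENNReal.ofReal q.β₁ * N.interferenceTR q.α q.d m ω) *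
      expNeg (ENNReal.ofReal q.β₂ * N.interferenceRT q.α q.d m ω) ∂P := by
  have hY₁ : Measurable[N.block {Source.forward m m}ᶜ]
      fun ω => ENNReal.ofReal q.β₁ * N.interferenceTR q.α q.d m ω :=
    (N.measurable_block_interferenceTR (by simp) (by simp) (by simp) (by simp) _ _).const_mul _
  have hY₂ : Measurable[N.block {Source.forward m m}ᶜ]
      fun ω => ENNReal.ofReal q.β₂ * N.interferenceRT q.α q.d m ω :=
    (N.measurable_block_interferenceRT (by simp) (by simp) (by simp) (by simp) _ _).const_mul _
  have hY₁' : Measurable[N.block {Source.reverse m m}ᶜ]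
      fun ω => ENNReal.ofReal q.β₁ * N.interferenceTR q.α q.d m ω :=
    (N.measurable_block_interferenceTR (by simp) (by simp) (by simp) (by simp) _ _).const_mul _
  have hY₂' : Measurable[N.block {Source.reverse m m}ᶜ]
      fun ω => ENNReal.ofReal q.β₂ * N.interferenceRT q.α q.d m ω :=
    (N.measurable_block_interferenceRT (by simp) (by simp) (by simp) (by simp) _ _).const_mul _
  have hG : Measurable[N.block {Source.forward m m}ᶜ] (N.inSet Q m) :=
    N.measurable_block_inSet hQ (by simp) (by simp)
  have hG' : Measurable[N.block {Source.reverse m m}ᶜ] (N.inSet Q m) :=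
    N.measurable_block_inSet hQ (by simp) (by simp)
  have hGi : Measurable[N.block {Source.forward m m}ᶜ] fun ω => N.inSet Q m ω *
      {ω | ENNReal.ofReal q.β₂ * N.interferenceRT q.α q.d m ω < ‖N.g m m ω‖ₑ ^ 2}.indicator 1 ω :=
    hG.mul ((measurable_one.indicator measurableSet_lt').comp (hY₂.prodMk
      ((measurable_enorm.comp (N.measurable_block_g (by simp))).pow_const 2)))
  have hGe : Measurable[N.block {Source.reverse m m}ᶜ] fun ω => N.inSet Q m ω *
      expNeg (ENNReal.ofReal q.β₁ * N.interferenceTR q.α q.d m ω) :=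
    hG'.mul (measurable_expNeg.comp hY₁')
  rw [lintegral_indicator_lt_enorm_sq (N.measurable_h m m) (hGi.mono (N.block_le _) le_rfl)
    (hY₁.mono (N.block_le _) le_rfl) (N.law_h m m)
    (N.indepFun_block disjoint_compl_left (hGi.prodMk hY₁)
      (N.measurable_block_h (Set.mem_singleton _)))]
  rw [lintegral_congr fun ω => mul_right_comm (N.inSet Q m ω) _
      (expNeg (ENNReal.ofReal q.β₁ * N.interferenceTR q.α q.d m ω)),
    lintegral_indicator_lt_enorm_sq (N.measurable_g m m) (hGe.mono (N.block_le _) le_rfl)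
    (hY₂'.mono (N.block_le _) le_rfl) (N.law_g m m)
    (N.indepFun_block disjoint_compl_left (hGe.prodMk hY₂')
      (N.measurable_block_g (Set.mem_singleton _)))]

lemma lintegral_prod_markFactor (q : Params) (x : Plane) (θ : ℝ) (t : ℕ → Plane) (m : ℕ)
    (s : Finset ℕ) :
    ∫⁻ ω, ∏ n ∈ s, markFactor q x θ (t n) (N.mark m n ω) ∂P =
      ∏ n ∈ s, pairFactor q N.accessProb θ x (t n) := by
  classical
  have hf : ∀ n, ∀ S : Set Source, markSources m n ⊆ S →
      Measurable[N.block S] fun ω => markFactor q x θ (t n) (N.mark m n ω) := fun n S hS =>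
    ((measurable_markFactor q).comp (measurable_prodMk_left (x := (x, θ, t n)))).comp
      (N.measurable_block_mark hS)
  induction s using Finset.induction_on with
  | empty => simp
  | insert n s hn ih =>
    simp_rw [Finset.prod_insert hn]
    rw [N.lintegral_mul_block (S := markSources m n) (S' := ⋃ k ∈ s, markSources m k) ?_
      (hf n _ subset_rfl) ?_, ih, N.lintegral_markFactor]
    · rw [Set.disjoint_iUnion₂_right]
      intro k hk
      have hne : n ≠ k := fun h => hn (h ▸ hk)
      simp [markSources, hne.symm]
    · exact Finset.measurable_fun_prod _ fun k hk => hf k _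
        (Set.subset_biUnion_of_mem (u := fun k => markSources m k) hk)

end Network

lemma prod_range_ite (m N : ℕ) (f : ℕ → ℝ≥0∞) :
    ∏ n ∈ Finset.range N, (if n ≠ m then f n else 1) =
      ∏ n ∈ (Finset.range N).filter (· ≠ m), f n :=
  (Finset.prod_filter _ _).symm

/-- The contribution of the pair `m` with direction `θ` to the expected number of successful pairs
with transmitter in `Q`, for access probability `a` and transmitter positions `t`. -/
def palmTerm (q : Params) (a : ℝ) (Q : Set Plane) (m : ℕ) (t : ℕ → Plane) (θ : ℝ) : ℝ≥0∞ :=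
  Q.indicator 1 (t m) * infProd fun n => if n ≠ m then pairFactor q a θ (t m) (t n) else 1

lemma measurable_palmTerm (q : Params) (a : ℝ) {Q : Set Plane} (hQ : MeasurableSet Q) (m : ℕ) :
    Measurable (Function.uncurry (palmTerm q a Q m)) := by
  refine ((measurable_one.indicator hQ).comp
    ((measurable_pi_apply m).comp measurable_fst)).mul (measurable_infProd fun n => ?_)
  by_cases hn : n = m
  · simp only [hn, ne_eq, not_true_eq_false, if_false]; exact measurable_const
  · simp only [ne_eq, hn, not_false_eq_true, if_true]
    exact (continuous_pairFactor q a).measurable.comp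
      (f := fun z : (ℕ → Plane) × ℝ => (z.2, z.1 m, z.1 n)) (by fun_prop)

lemma tsum_palmTerm (q : Params) (a : ℝ) (Q : Set Plane) (t : ℕ → Plane) (θ : ℝ) :
    ∑' m, palmTerm q a Q m t θ = productSum (pairFactor q a θ) (Q.indicator 1) Set.univ t := by
  refine tsum_congr fun m => ?_
  simp only [palmTerm, Set.mem_univ, and_true]

/-- The mean number of pairs, per unit of density, that prevent the success of a pair with
direction `θ`. -/
def outageArea (q : Params) (θ : ℝ) : ℝ≥0∞ := ∫⁻ z, (1 - activeFactor q θ z)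

lemma measurable_outageArea (q : Params) : Measurable (outageArea q) :=
  (measurable_const.sub (continuous_activeFactor q).measurable).lintegral_prod_right

namespace Network

variable {Ω : Type*} [MeasurableSpace Ω] {P : Measure Ω} {lam : ℝ} (N : Network P lam)

/-- The positions of all transmitters. -/
def positions (ω : Ω) : ℕ → Plane := fun n => N.T n ω

lemma measurable_block_positions {S : Set Source} (hS : Source.positions ∈ S) :
    Measurable[N.block S] N.positions :=
  @measurable_pi_lambda _ _ _ (N.block S) _ _ fun n => N.measurable_block_T hS n

lemma measurable_positions : Measurable N.positions := measurable_pi_lambda _ N.ppp_T.1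

variable [IsProbabilityMeasure P]

lemma lintegral_inSet_mul_prod (q : Params) {Q : Set Plane} (hQ : MeasurableSet Q) (m : ℕ)
    {s : Finset ℕ} (hs : m ∉ s) :
    ∫⁻ ω, N.inSet Q m ω * ∏ n ∈ s,
        markFactor q (N.T m ω) (N.angle m ω) (N.T n ω) (N.mark m n ω) ∂P =
      ∫⁻ ω, N.inSet Q m ω * ∏ n ∈ s,
        pairFactor q N.accessProb (N.angle m ω) (N.T m ω) (N.T n ω) ∂P := by
  let X : Ω → (ℕ → Plane) × ℝ × Bool := fun ω => (N.positions ω, N.angle m ω, N.active m ω)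
  let Y : Ω → s → Mark := fun ω n => N.mark m n ω
  let F : (ℕ → Plane) × ℝ × Bool → (s → Mark) → ℝ≥0∞ := fun x y =>
    (Q.indicator 1 (x.1 m) * if x.2.2 = true then 1 else 0) *
      ∏ n : s, markFactor q (x.1 m) x.2.1 (x.1 n) (y n)
  have hXb : Measurable[N.block {.positions, .direction m, .access m}] X :=
    (N.measurable_block_positions (by simp)).prodMk
      ((N.measurable_block_angle (by simp)).prodMk (N.measurable_block_active (by simp)))
  have hYb : Measurable[N.block (⋃ n ∈ s, markSources m n)] Y :=
    @measurable_pi_lambda _ _ _ (N.block (⋃ n ∈ s, markSources m n)) _ _ fun n =>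
      N.measurable_block_mark (Set.subset_biUnion_of_mem (u := fun k => markSources m k) n.2)
  have hX : Measurable X := hXb.mono (N.block_le _) le_rfl
  have hY : Measurable Y := hYb.mono (N.block_le _) le_rfl
  have hdisj : Disjoint ({.positions, .direction m, .access m} : Set Source)
      (⋃ n ∈ s, markSources m n) := by
    rw [Set.disjoint_iUnion₂_right]
    intro k hk
    have hne : m ≠ k := fun h => hs (h ▸ hk)
    simp [markSources, hne.symm]
  have hbool : Measurable fun b : Bool => if b = true then (1 : ℝ≥0∞) else 0 :=
    measurable_of_countable _
  have hterm : ∀ n : s, Measurable fun z : ((ℕ → Plane) × ℝ × Bool) × (s → Mark) =>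
      markFactor q (z.1.1 m) z.1.2.1 (z.1.1 n) (z.2 n) := fun n =>
    (measurable_markFactor q).comp
      (f := fun z : ((ℕ → Plane) × ℝ × Bool) × (s → Mark) =>
        ((z.1.1 m, z.1.2.1, z.1.1 n), z.2 n)) (by fun_prop)
  have hF : Measurable (Function.uncurry F) := by
    refine Measurable.mul (Measurable.mul ?_ ?_) (Finset.measurable_fun_prod _ fun n _ => hterm n)
    · exact (measurable_one.indicator hQ).comp
        (f := fun z : ((ℕ → Plane) × ℝ × Bool) × (s → Mark) => z.1.1 m) (by fun_prop)
    · exact hbool.comp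
        (f := fun z : ((ℕ → Plane) × ℝ × Bool) × (s → Mark) => z.1.2.2) (by fun_prop)
  have h := lintegral_of_indepFun hX hY (N.indepFun_block hdisj hXb hYb) hF
  have hl : ∀ ω, F (X ω) (Y ω) = N.inSet Q m ω * ∏ n ∈ s,
      markFactor q (N.T m ω) (N.angle m ω) (N.T n ω) (N.mark m n ω) := fun ω => by
    rw [← Finset.prod_coe_sort]; rfl
  have hr : ∀ ω, ∫⁻ y, F (X ω) y ∂(P.map Y) = N.inSet Q m ω * ∏ n ∈ s,
      pairFactor q N.accessProb (N.angle m ω) (N.T m ω) (N.T n ω) := fun ω => by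
    have hFω : Measurable (F (X ω)) := hF.comp measurable_prodMk_left
    rw [lintegral_map hFω hY,
      ← N.lintegral_prod_markFactor q (N.T m ω) (N.angle m ω) (fun n => N.T n ω) m s]
    simp only [← Finset.prod_coe_sort s]
    exact lintegral_const_mul _ ((Finset.measurable_fun_prod _ fun n _ =>
      (hterm n).comp measurable_prodMk_left).comp (f := fun ω' => Y ω') hY)
  simp_rw [hl, hr] at h
  exact h

lemma lintegral_inSet_mul_expNeg (q : Params) {Q : Set Plane} (hQ : MeasurableSet Q) (m : ℕ) :
    ∫⁻ ω, N.inSet Q m ω * expNeg (ENNReal.ofReal q.β₁ * N.interferenceTR q.α q.d m ω) *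
      expNeg (ENNReal.ofReal q.β₂ * N.interferenceRT q.α q.d m ω) ∂P =
    ∫⁻ ω, N.inSet Q m ω * infProd (fun n => if n ≠ m then
      pairFactor q N.accessProb (N.angle m ω) (N.T m ω) (N.T n ω) else 1) ∂P := by
  have hin : Measurable (N.inSet Q m) :=
    (N.measurable_block_inSet hQ (Set.mem_univ _) (Set.mem_univ _)).mono
      (N.block_le Set.univ) le_rfl
  have hT := N.ppp_T.1
  have ha := N.measurable_angle
  have hmark := N.measurable_mark
  have key : ∀ f : ℕ → Ω → ℝ≥0∞, (∀ n, Measurable (f n)) → (∀ n ω, f n ω ≤ 1) →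
      Tendsto (fun K => ∫⁻ ω, N.inSet Q m ω *
        ∏ n ∈ (Finset.range K).filter (· ≠ m), f n ω ∂P) atTop
      (𝓝 (∫⁻ ω, N.inSet Q m ω * infProd (fun n => if n ≠ m then f n ω else 1) ∂P)) := by
    intro f hf hf1
    refine tendsto_lintegral_of_dominated_convergence (fun _ => 1)
      (fun K => hin.mul (Finset.measurable_fun_prod _ fun n _ => hf n))
      (fun K => ae_of_all _ fun ω => mul_le_one' (N.inSet_le_one Q m ω)
        (Finset.prod_le_one' fun n _ => hf1 n ω)) (by simp) (ae_of_all _ fun ω => ?_)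
    simp_rw [← prod_range_ite]
    exact ENNReal.Tendsto.const_mul
      (tendsto_infProd fun n => by split_ifs <;> simp [hf1])
      (Or.inr ((N.inSet_le_one Q m ω).trans_lt ENNReal.one_lt_top).ne)
  have hmf : ∀ n, Measurable fun ω =>
      markFactor q (N.T m ω) (N.angle m ω) (N.T n ω) (N.mark m n ω) := fun n =>
    (measurable_markFactor q).comp
      (f := fun ω => ((N.T m ω, N.angle m ω, N.T n ω), N.mark m n ω)) (by fun_prop)
  have hpf : ∀ n, Measurable fun ω =>
      pairFactor q N.accessProb (N.angle m ω) (N.T m ω) (N.T n ω) := fun n =>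
    (continuous_pairFactor q N.accessProb).measurable.comp
      (f := fun ω => (N.angle m ω, N.T m ω, N.T n ω)) (by fun_prop)
  have h1 := key _ hmf fun n ω => markFactor_le_one _ _ _ _ _
  have h2 := key _ hpf fun n ω =>
    pairFactor_le_one q N.accessProb_pos.le N.accessProb_le_one _ _ _
  simp_rw [mul_assoc, N.expNeg_interference]
  refine tendsto_nhds_unique (h1.congr fun K => ?_) h2
  exact N.lintegral_inSet_mul_prod q hQ m (by simp)

lemma lintegral_inSet_mul_infProd (q : Params) {Q : Set Plane} (hQ : MeasurableSet Q) (m : ℕ) :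
    ∫⁻ ω, N.inSet Q m ω * infProd (fun n => if n ≠ m then
      pairFactor q N.accessProb (N.angle m ω) (N.T m ω) (N.T n ω) else 1) ∂P =
    ENNReal.ofReal N.accessProb * ∫⁻ θ, ∫⁻ ω, palmTerm q N.accessProb Q m (N.positions ω) θ ∂P
      ∂angleLaw := by
  have hsplit : ∀ ω, N.inSet Q m ω * infProd (fun n => if n ≠ m then
      pairFactor q N.accessProb (N.angle m ω) (N.T m ω) (N.T n ω) else 1) =
      (if N.active m ω = true then 1 else 0) *
        palmTerm q N.accessProb Q m (N.positions ω) (N.angle m ω) := fun ω => by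
    rw [inSet, mul_comm (Q.indicator 1 _), mul_assoc]; rfl
  have hact : Measurable[N.block {.access m}] fun ω =>
      if N.active m ω = true then (1 : ℝ≥0∞) else 0 :=
    (measurable_of_countable fun b : Bool => if b = true then (1 : ℝ≥0∞) else 0).comp
      (N.measurable_block_active (Set.mem_singleton _))
  have hp : Measurable[N.block {.positions, .direction m}] fun ω =>
      palmTerm q N.accessProb Q m (N.positions ω) (N.angle m ω) :=
    (measurable_palmTerm q N.accessProb hQ m).comp
      ((N.measurable_block_positions (by simp)).prodMk (N.measurable_block_angle (by simp)))
  have hprob := N.lintegral_active m 1 0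
  simp only [one_mul, zero_mul, add_zero] at hprob
  simp_rw [hsplit]
  rw [N.lintegral_mul_block (by simp) hact hp, hprob,
    lintegral_of_indepFun N.measurable_positions (N.measurable_angle m)
      (N.indepFun_block (S := {.positions}) (S' := {.direction m}) (by simp)
        (N.measurable_block_positions (Set.mem_singleton _))
        (N.measurable_block_angle (Set.mem_singleton _))) (measurable_palmTerm q _ hQ m),
    N.map_angle, lintegral_lintegral_swap]
  exact ((measurable_palmTerm q N.accessProb hQ m).comp
    (f := fun z : Ω × ℝ => (N.positions z.1, z.2))
    ((N.measurable_positions.comp measurable_fst).prodMk measurable_snd)).aemeasurable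

lemma lintegral_encard_success {q : Params} (hd : 0 < q.d) (hFTR : 0 < q.FTR)
    (hFRT : q.FTR < q.Ftotal) (hBTR : 0 < q.BTR) (hBRT : 0 < q.BRT) {Q : Set Plane}
    (hQ : MeasurableSet Q) (hQfin : volume Q < ∞) :
    ∫⁻ ω, ({m | N.T m ω ∈ Q ∧ N.active m ω = true ∧ N.Success q m ω}.encard : ℝ≥0∞) ∂P =
      ENNReal.ofReal lam * volume Q * ∫⁻ θ, expNeg (ENNReal.ofReal lam * outageArea q θ)
        ∂angleLaw := by
  have hlam : ENNReal.ofReal N.accessProb * ENNReal.ofReal N.baseDensity = ENNReal.ofReal lam := by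
    rw [← ENNReal.ofReal_mul N.accessProb_pos.le, ← N.density_eq]
  have hterm : ∀ m ω, {m | N.T m ω ∈ Q ∧ N.active m ω = true ∧ N.Success q m ω}.indicator
      (1 : ℕ → ℝ≥0∞) m = N.inSet Q m ω *
      {ω | ENNReal.ofReal q.β₂ * N.interferenceRT q.α q.d m ω < ‖N.g m m ω‖ₑ ^ 2}.indicator 1 ω *
      {ω | ENNReal.ofReal q.β₁ * N.interferenceTR q.α q.d m ω < ‖N.h m m ω‖ₑ ^ 2}.indicator 1 ω := by
    intro m ω
    simp only [Set.indicator_apply, Set.mem_ofPred_eq, N.success_iff hd hFTR hFRT hBTR hBRT, inSet,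
      Pi.one_apply]
    by_cases h1 : N.T m ω ∈ Q <;> by_cases h2 : N.active m ω = true <;>
    by_cases h3 : ENNReal.ofReal q.β₁ * N.interferenceTR q.α q.d m ω < ‖N.h m m ω‖ₑ ^ 2 <;>
    by_cases h4 : ENNReal.ofReal q.β₂ * N.interferenceRT q.α q.d m ω < ‖N.g m m ω‖ₑ ^ 2 <;>
    simp [h1, h2, h3, h4]
  have hI1 : ∀ m, Measurable (N.interferenceTR q.α q.d m) := fun m =>
    (N.measurable_block_interferenceTR (S := Set.univ) (by simp) (by simp) (by simp) (by simp)
      _ _).mono (N.block_le _) le_rfl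
  have hI2 : ∀ m, Measurable (N.interferenceRT q.α q.d m) := fun m =>
    (N.measurable_block_interferenceRT (S := Set.univ) (by simp) (by simp) (by simp) (by simp)
      _ _).mono (N.block_le _) le_rfl
  have hin : ∀ m, Measurable (N.inSet Q m) := fun m =>
    (N.measurable_block_inSet hQ (Set.mem_univ _) (Set.mem_univ _)).mono
      (N.block_le Set.univ) le_rfl
  have hg := N.measurable_g
  have hh := N.measurable_h
  have hpalm : ∀ m, Measurable fun z : ℝ × Ω => palmTerm q N.accessProb Q m (N.positions z.2) z.1 :=
    fun m => (measurable_palmTerm q N.accessProb hQ m).comp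
      (f := fun z : ℝ × Ω => (N.positions z.2, z.1))
      ((N.measurable_positions.comp measurable_snd).prodMk measurable_fst)
  simp_rw [encard_eq_tsum_indicator, hterm]
  have hmeas : ∀ m, Measurable fun ω => N.inSet Q m ω *
      {ω | ENNReal.ofReal q.β₂ * N.interferenceRT q.α q.d m ω < ‖N.g m m ω‖ₑ ^ 2}.indicator 1 ω *
      {ω | ENNReal.ofReal q.β₁ * N.interferenceTR q.α q.d m ω < ‖N.h m m ω‖ₑ ^ 2}.indicator 1 ω :=
    fun m => ((hin m).mul (measurable_one.indicator
      (measurableSet_lt (by fun_prop) (by fun_prop)))).mul (measurable_one.indicator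
      (measurableSet_lt (by fun_prop) (by fun_prop)))
  rw [lintegral_tsum fun m => (hmeas m).aemeasurable]
  simp_rw [N.lintegral_direct_links q hQ, N.lintegral_inSet_mul_expNeg q hQ,
    N.lintegral_inSet_mul_infProd q hQ]
  rw [ENNReal.tsum_mul_left, ← lintegral_tsum fun m => (hpalm m).lintegral_prod_right.aemeasurable]
  have hmecke : ∀ θ, ∑' m, ∫⁻ ω, palmTerm q N.accessProb Q m (N.positions ω) θ ∂P =
      ENNReal.ofReal N.baseDensity * (volume Q * expNeg (ENNReal.ofReal lam * outageArea q θ)) := by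
    intro θ
    have hpθ : ∀ m, Measurable fun ω => palmTerm q N.accessProb Q m (N.positions ω) θ :=
      fun m => (hpalm m).comp measurable_prodMk_left
    rw [← lintegral_tsum fun m => (hpθ m).aemeasurable]
    simp_rw [tsum_palmTerm]
    have hΦ : Continuous (Function.uncurry (pairFactor q N.accessProb θ)) :=
      (continuous_pairFactor q N.accessProb).comp
        (f := fun z : Plane × Plane => (θ, z.1, z.2)) (by fun_prop)
    rw [show (fun ω => productSum (pairFactor q N.accessProb θ) (Q.indicator 1) Set.univ
      (N.positions ω)) = fun ω => productSum (pairFactor q N.accessProb θ) (Q.indicator 1) Set.univ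
      (N.T · ω) from rfl, N.ppp_T.lintegral_productSum N.baseDensity_pos.le hQ hQfin hΦ
      (pairFactor_le_one q N.accessProb_pos.le N.accessProb_le_one θ)]
    have hint : ∀ x, ENNReal.ofReal N.baseDensity *
        ∫⁻ y, (1 - pairFactor q N.accessProb θ x y) = ENNReal.ofReal lam * outageArea q θ := by
      intro x
      simp_rw [one_sub_pairFactor q N.accessProb_pos.le N.accessProb_le_one]
      rw [lintegral_const_mul' _ _ ENNReal.ofReal_ne_top, ← mul_assoc, mul_comm (ENNReal.ofReal _),
        hlam, outageArea, lintegral_sub_right_eq_self fun z => 1 - activeFactor q θ z]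
    simp_rw [hint]
    rw [setLIntegral_const, mul_comm (volume Q)]
  simp_rw [hmecke]
  have hm : Measurable fun θ => expNeg (ENNReal.ofReal lam * outageArea q θ) :=
    measurable_expNeg.comp ((measurable_outageArea q).const_mul _)
  rw [lintegral_const_mul _ (hm.const_mul _), lintegral_const_mul _ hm, ← mul_assoc, hlam, mul_assoc]

lemma lintegral_encard_active {Q : Set Plane} (hQ : MeasurableSet Q) (hQfin : volume Q < ∞) :
    ∫⁻ ω, ({m | N.T m ω ∈ Q ∧ N.active m ω = true}.encard : ℝ≥0∞) ∂P =
      ENNReal.ofReal lam * volume Q := by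
  have hterm : ∀ m ω, {m | N.T m ω ∈ Q ∧ N.active m ω = true}.indicator (1 : ℕ → ℝ≥0∞) m =
      Q.indicator 1 (N.T m ω) * (if N.active m ω = true then 1 else 0) := by
    intro m ω
    by_cases h1 : N.T m ω ∈ Q <;> by_cases h2 : N.active m ω = true <;> simp [h1, h2]
  have hT : ∀ m, Measurable[N.block {.positions}] fun ω => Q.indicator (1 : Plane → ℝ≥0∞) (N.T m ω) :=
    fun m => (measurable_one.indicator hQ).comp (N.measurable_block_T (Set.mem_singleton _) m)
  have hact : ∀ m, Measurable[N.block {.access m}] fun ω =>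
      if N.active m ω = true then (1 : ℝ≥0∞) else 0 := fun m =>
    (measurable_of_countable fun b : Bool => if b = true then (1 : ℝ≥0∞) else 0).comp
      (N.measurable_block_active (Set.mem_singleton _))
  have hprob : ∀ m, ∫⁻ ω, (if N.active m ω = true then (1 : ℝ≥0∞) else 0) ∂P =
      ENNReal.ofReal N.accessProb := fun m => by simpa using N.lintegral_active m 1 0
  have hT' := fun m => (hT m).mono (N.block_le _) le_rfl
  have hact' := fun m => (hact m).mono (N.block_le _) le_rfl
  simp_rw [encard_eq_tsum_indicator, hterm]
  have hmeas : ∀ m, Measurable fun ω =>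
      Q.indicator (1 : Plane → ℝ≥0∞) (N.T m ω) * (if N.active m ω = true then 1 else 0) :=
    fun m => (hT' m).mul (hact' m)
  rw [lintegral_tsum fun m => (hmeas m).aemeasurable]
  have hm : ∀ m, ∫⁻ ω, Q.indicator 1 (N.T m ω) * (if N.active m ω = true then 1 else 0) ∂P =
      (∫⁻ ω, Q.indicator 1 (N.T m ω) ∂P) * ENNReal.ofReal N.accessProb := fun m => by
    rw [N.lintegral_mul_block (by simp) (hT m) (hact m), hprob]
  simp_rw [hm]
  rw [ENNReal.tsum_mul_right, ← lintegral_tsum fun m => (hT' m).aemeasurable]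
  have henc := N.ppp_T.lintegral_encard N.baseDensity_pos.le hQ hQfin
  simp_rw [encard_eq_tsum_indicator] at henc
  have : ∀ ω m, {n | N.T n ω ∈ Q}.indicator (1 : ℕ → ℝ≥0∞) m = Q.indicator 1 (N.T m ω) :=
    fun _ _ => rfl
  simp_rw [this] at henc
  rw [henc, mul_right_comm, ← ENNReal.ofReal_mul N.baseDensity_pos.le, mul_comm N.baseDensity,
    ← N.density_eq]

end Network

lemma measurableSet_unitSquare : MeasurableSet unitSquare := by
  have : unitSquare = ⋂ i, (fun x : Plane => x i) ⁻¹' Set.Ico 0 1 := by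
    ext x; simp [unitSquare]
  rw [this]
  exact MeasurableSet.iInter fun i => (by fun_prop : Measurable fun x : Plane => x i) measurableSet_Ico

lemma volume_unitSquare : volume unitSquare = 1 := by
  have h : unitSquare = (WithLp.ofLp (p := 2)) ⁻¹' (Set.univ.pi fun _ : Fin 2 => Set.Ico (0 : ℝ) 1) := by
    ext x; simp [unitSquare]
  rw [h, (PiLp.volume_preserving_ofLp (Fin 2)).measure_preimage
    (MeasurableSet.univ_pi fun _ => measurableSet_Ico).nullMeasurableSet, volume_pi_pi]
  simp

/-- The success probability of the typical active pair. -/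
theorem Network.successProb_eq {Ω : Type*} [MeasurableSpace Ω] {P : Measure Ω}
    [IsProbabilityMeasure P] {lam : ℝ} (N : Network P lam) {q : Params} (hd : 0 < q.d)
    (hFTR : 0 < q.FTR) (hFRT : q.FTR < q.Ftotal) (hBTR : 0 < q.BTR) (hBRT : 0 < q.BRT) :
    N.successProb q =
      (∫⁻ θ, expNeg (ENNReal.ofReal lam * outageArea q θ) ∂angleLaw).toReal := by
  have hlam : 0 < lam := by
    rw [N.density_eq]; exact mul_pos N.accessProb_pos N.baseDensity_pos
  have hvol : volume unitSquare < ∞ := by simp [volume_unitSquare]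
  rw [successProb, N.lintegral_encard_success hd hFTR hFRT hBTR hBRT measurableSet_unitSquare hvol,
    N.lintegral_encard_active measurableSet_unitSquare hvol, volume_unitSquare, mul_one,
    mul_comm, ENNReal.mul_div_cancel_right (by simpa using hlam) ENNReal.ofReal_ne_top]

/-! ### Bounds for the outage area -/

lemma one_sub_mul_le {a b : ℝ≥0∞} (ha : a ≤ 1) (hb : b ≤ 1) : 1 - a * b ≤ (1 - a) + (1 - b) := by
  refine tsub_le_iff_right.2 ?_
  calc (1 : ℝ≥0∞) = (1 - a) + a * ((1 - b) + b) := by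
        rw [tsub_add_cancel_of_le hb, mul_one, tsub_add_cancel_of_le ha]
    _ ≤ (1 - a) + ((1 - b) + a * b) := by
        rw [mul_add]; gcongr; exact mul_le_of_le_one_left' ha
    _ = _ := by rw [add_assoc]

lemma one_sub_sq_add_le {a b : ℝ≥0∞} (ha : a ≤ 1) (hb : b ≤ 1) :
    (1 - a ^ 2) + (1 - b ^ 2) ≤ 2 * (1 - a * b) := by
  lift a to NNReal using (ha.trans_lt ENNReal.one_lt_top).ne
  lift b to NNReal using (hb.trans_lt ENNReal.one_lt_top).ne
  have ha' : a ≤ 1 := by exact_mod_cast ha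
  have hb' : b ≤ 1 := by exact_mod_cast hb
  have h : (1 - a ^ 2) + (1 - b ^ 2) ≤ 2 * (1 - a * b) := by
    rw [← NNReal.coe_le_coe]
    push_cast [NNReal.coe_sub (pow_le_one₀ zero_le ha'), NNReal.coe_sub (pow_le_one₀ zero_le hb'),
      NNReal.coe_sub (mul_le_one' ha' hb')]
    nlinarith [sq_nonneg ((a : ℝ) - b)]
  exact_mod_cast h

lemma lintegral_angleLaw_one_sub {f : ℝ → ℝ≥0∞} (hf : Measurable f) (hf1 : ∀ θ, f θ ≤ 1) :
    ∫⁻ θ, (1 - f θ) ∂angleLaw = 1 - ∫⁻ θ, f θ ∂angleLaw := by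
  have hle : ∫⁻ θ, f θ ∂angleLaw ≤ 1 := (lintegral_mono hf1).trans_eq (by simp)
  rw [lintegral_sub hf (hle.trans_lt ENNReal.one_lt_top).ne (ae_of_all _ hf1)]
  simp

section Average

variable {f g : Plane → ℝ≥0∞} {b : ℝ → Plane}

/-- Union bound for the displaced factors `f` and `g`. -/
lemma lintegral_one_sub_mul_average_le (hf : Measurable f) (hg : Measurable g)
    (hf1 : ∀ z, f z ≤ 1) (hg1 : ∀ z, g z ≤ 1) (a : Plane) (hb : Measurable b) :
    ∫⁻ z, (1 - f (z - a) * ∫⁻ θ, g (z + b θ) ∂angleLaw) ≤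
      (∫⁻ z, (1 - f z)) + ∫⁻ z, (1 - g z) := by
  have hgb : Measurable fun z : Plane × ℝ => 1 - g (z.1 + b z.2) :=
    measurable_const.sub (hg.comp (measurable_fst.add (hb.comp measurable_snd)))
  have hle : ∀ z, 1 - f (z - a) * ∫⁻ θ, g (z + b θ) ∂angleLaw ≤
      (1 - f (z - a)) + ∫⁻ θ, (1 - g (z + b θ)) ∂angleLaw := by
    intro z
    have hgz : Measurable fun θ => g (z + b θ) := hg.comp (measurable_const.add hb)
    rw [lintegral_angleLaw_one_sub hgz fun _ => hg1 _]
    exact one_sub_mul_le (hf1 _) ((lintegral_mono fun _ => hg1 _).trans_eq (by simp))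
  refine (lintegral_mono hle).trans_eq ?_
  have hfa : Measurable fun z : Plane => 1 - f (z - a) :=
    measurable_const.sub (hf.comp (measurable_id.sub_const a))
  have htr : ∀ θ, ∫⁻ z, (1 - g (z + b θ)) = ∫⁻ z, (1 - g z) := fun θ =>
    lintegral_add_right_eq_self (fun z => 1 - g z) _
  rw [lintegral_add_left hfa, lintegral_lintegral_swap hgb.aemeasurable,
    lintegral_sub_right_eq_self fun z => 1 - f z]
  simp [htr]

/-- The displaced factors are least correlated when they coincide. -/
lemma le_lintegral_one_sub_mul_average (hf : Measurable f) (hg : Measurable g)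
    (hf1 : ∀ z, f z ≤ 1) (hg1 : ∀ z, g z ≤ 1) (a : Plane) (hb : Measurable b) :
    (∫⁻ z, (1 - f z ^ 2)) + ∫⁻ z, (1 - g z ^ 2) ≤
      2 * ∫⁻ z, (1 - f (z - a) * ∫⁻ θ, g (z + b θ) ∂angleLaw) := by
  have hgb : Measurable fun z : Plane × ℝ => 1 - g (z.1 + b z.2) ^ 2 :=
    measurable_const.sub ((hg.comp (measurable_fst.add (hb.comp measurable_snd))).pow_const 2)
  have hle : ∀ z, (1 - f (z - a) ^ 2) + ∫⁻ θ, (1 - g (z + b θ) ^ 2) ∂angleLaw ≤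
      2 * (1 - f (z - a) * ∫⁻ θ, g (z + b θ) ∂angleLaw) := by
    intro z
    have hgz : Measurable fun θ => g (z + b θ) := hg.comp (measurable_const.add hb)
    have hfg : Measurable fun θ => f (z - a) * g (z + b θ) := hgz.const_mul _
    have hmean : 1 - f (z - a) * ∫⁻ θ, g (z + b θ) ∂angleLaw =
        ∫⁻ θ, (1 - f (z - a) * g (z + b θ)) ∂angleLaw := by
      rw [lintegral_angleLaw_one_sub hfg fun _ => mul_le_one' (hf1 _) (hg1 _),
        lintegral_const_mul _ hgz]
    calc (1 - f (z - a) ^ 2) + ∫⁻ θ, (1 - g (z + b θ) ^ 2) ∂angleLaw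
        = ∫⁻ θ, ((1 - f (z - a) ^ 2) + (1 - g (z + b θ) ^ 2)) ∂angleLaw := by
          rw [lintegral_add_left measurable_const]; simp
      _ ≤ ∫⁻ θ, 2 * (1 - f (z - a) * g (z + b θ)) ∂angleLaw :=
          lintegral_mono fun θ => one_sub_sq_add_le (hf1 _) (hg1 _)
      _ = _ := by rw [hmean, lintegral_const_mul' _ _ (by simp)]
  have hint := lintegral_mono (μ := (volume : Measure Plane)) hle
  have hfa : Measurable fun z : Plane => 1 - f (z - a) ^ 2 :=
    measurable_const.sub ((hf.comp (measurable_id.sub_const a)).pow_const 2)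
  have htr : ∀ θ, ∫⁻ z, (1 - g (z + b θ) ^ 2) = ∫⁻ z, (1 - g z ^ 2) := fun θ =>
    lintegral_add_right_eq_self (fun z => 1 - g z ^ 2) _
  rw [lintegral_add_left hfa, lintegral_lintegral_swap hgb.aemeasurable,
    lintegral_sub_right_eq_self fun z => 1 - f z ^ 2,
    lintegral_const_mul' _ _ (by simp)] at hint
  simpa [htr] using hint

end Average

lemma outageArea_eq (q : Params) (θ : ℝ) :
    outageArea q θ = ∫⁻ z, (1 - fade q.α q.β₁ (z - q.d • dir θ) *
      ∫⁻ θ', fade q.α q.β₂ (z + q.d • dir θ') ∂angleLaw) := by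
  simp only [outageArea, activeFactor]

lemma measurable_smul_dir (d : ℝ) : Measurable fun θ => d • dir θ :=
  (continuous_dir.const_smul d).measurable

lemma outageArea_le {q : Params} (hα : 2 < q.α) (h₁ : 0 < q.β₁) (h₂ : 0 < q.β₂) (θ : ℝ) :
    outageArea q θ ≤ ENNReal.ofReal (q.c₁ * (q.β₁ ^ (2 / q.α) + q.β₂ ^ (2 / q.α))) := by
  have hC := radialConst_pos hα
  have h := lintegral_one_sub_mul_average_le (continuous_fade q.α q.β₁).measurable
    (continuous_fade q.α q.β₂).measurable (fade_le_one _ _) (fade_le_one _ _) (q.d • dir θ)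
    (measurable_smul_dir q.d)
  rw [lintegral_one_sub_fade hα h₁, lintegral_one_sub_fade hα h₂,
    ← ENNReal.ofReal_add (by positivity) (by positivity), ← mul_add] at h
  rw [outageArea_eq]
  exact h

lemma le_outageArea {q : Params} (hα : 2 < q.α) (h₁ : 0 < q.β₁) (h₂ : 0 < q.β₂) (θ : ℝ) :
    ENNReal.ofReal (q.c₂ * (q.β₁ ^ (2 / q.α) + q.β₂ ^ (2 / q.α))) ≤ outageArea q θ := by
  have hC := radialConst_pos hα
  have hα0 : 0 < q.α := by linarith
  have h := le_lintegral_one_sub_mul_average (continuous_fade q.α q.β₁).measurable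
    (continuous_fade q.α q.β₂).measurable (fade_le_one _ _) (fade_le_one _ _) (q.d • dir θ)
    (measurable_smul_dir q.d)
  rw [lintegral_one_sub_fade_sq hα h₁, lintegral_one_sub_fade_sq hα h₂,
    ← ENNReal.ofReal_add (by positivity) (by positivity), ← outageArea_eq] at h
  refine (ENNReal.mul_le_mul_iff_right two_ne_zero ENNReal.ofNat_ne_top).1
    (le_trans (le_of_eq ?_) h)
  rw [← ENNReal.ofReal_ofNat, ← ENNReal.ofReal_mul (by norm_num)]
  congr 1
  rw [Params.c₂, radialConst]
  field_simp

lemma Params.c₁_pos {q : Params} (hα : 2 < q.α) : 0 < q.c₁ := radialConst_pos hα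

lemma Params.c₂_eq {q : Params} (hα : 2 < q.α) : q.c₂ = q.c₁ * (1 / 2 + 1 / q.α) := by
  rw [Params.c₁, Params.c₂]
  field_simp

/-! ### The success probability as a function of the density -/

section ExpNegAverage

variable {K : ℝ → ℝ≥0∞}

lemma continuous_average_expNeg (hK : Measurable K) (hK' : ∀ θ, K θ ≠ ∞) :
    Continuous fun l : ℝ => (∫⁻ θ, expNeg (ENNReal.ofReal l * K θ) ∂angleLaw).toReal := by
  have hfin : ∀ l : ℝ, ∫⁻ θ, expNeg (ENNReal.ofReal l * K θ) ∂angleLaw ≠ ∞ := fun l =>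
    (((lintegral_mono fun _ => expNeg_le_one _).trans_eq (by simp)).trans_lt
      ENNReal.one_lt_top).ne
  refine continuous_iff_continuousAt.2 fun l => (ENNReal.tendsto_toReal (hfin l)).comp ?_
  refine tendsto_lintegral_filter_of_dominated_convergence (fun _ => 1)
    (Eventually.of_forall fun x => measurable_expNeg.comp (hK.const_mul _))
    (Eventually.of_forall fun x => ae_of_all _ fun θ => expNeg_le_one _) (by simp)
    (ae_of_all _ fun θ => (continuous_expNeg.tendsto _).comp ?_)
  exact ENNReal.Tendsto.mul_const (ENNReal.continuous_ofReal.tendsto l) (Or.inr (hK' θ))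

lemma average_expNeg_le {c l : ℝ} (hc : 0 ≤ c) (hl : 0 ≤ l) (h : ∀ θ, ENNReal.ofReal c ≤ K θ) :
    (∫⁻ θ, expNeg (ENNReal.ofReal l * K θ) ∂angleLaw).toReal ≤ Real.exp (-(l * c)) := by
  refine ENNReal.toReal_le_of_le_ofReal (Real.exp_pos _).le ?_
  calc ∫⁻ θ, expNeg (ENNReal.ofReal l * K θ) ∂angleLaw
      ≤ ∫⁻ _, ENNReal.ofReal (Real.exp (-(l * c))) ∂angleLaw := lintegral_mono fun θ => by
        rw [← expNeg_ofReal (by positivity), ENNReal.ofReal_mul hl]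
        exact expNeg_antitone (by gcongr; exact h θ)
    _ = _ := by simp

lemma le_average_expNeg {c l : ℝ} (hc : 0 ≤ c) (hl : 0 ≤ l) (h : ∀ θ, K θ ≤ ENNReal.ofReal c) :
    Real.exp (-(l * c)) ≤ (∫⁻ θ, expNeg (ENNReal.ofReal l * K θ) ∂angleLaw).toReal := by
  have hfin : ∫⁻ θ, expNeg (ENNReal.ofReal l * K θ) ∂angleLaw ≠ ∞ :=
    (((lintegral_mono fun _ => expNeg_le_one _).trans_eq (by simp)).trans_lt
      ENNReal.one_lt_top).ne
  refine (ENNReal.ofReal_le_iff_le_toReal hfin).1 ?_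
  calc ENNReal.ofReal (Real.exp (-(l * c)))
      = ∫⁻ _, ENNReal.ofReal (Real.exp (-(l * c))) ∂angleLaw := by simp
    _ ≤ ∫⁻ θ, expNeg (ENNReal.ofReal l * K θ) ∂angleLaw := lintegral_mono fun θ => by
        rw [← expNeg_ofReal (by positivity), ENNReal.ofReal_mul hl]
        exact expNeg_antitone (by gcongr; exact h θ)

end ExpNegAverage

/-- The largest admissible density, for a success probability that depends continuously on the
density and lies between two exponentials. -/
lemma maxDensity_of_exp_bounds {p : Set.Ioi (0 : ℝ) → ℝ} {s : ℝ → ℝ} (hs : Continuous s)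
    (hp : ∀ l, p l = s l) {L U ε : ℝ} (hL : 0 < L) (hU : 0 < U) (hε0 : 0 < ε) (hε1 : ε < 1)
    (hsL : ∀ l, 0 < l → s l ≤ Real.exp (-(l * L)))
    (hsU : ∀ l, 0 < l → Real.exp (-(l * U)) ≤ s l) :
    (∃ hl : 0 < maxDensity p ε, IsGreatest (admissibleDensities p ε) (maxDensity p ε) ∧
      p ⟨maxDensity p ε, hl⟩ = 1 - ε) ∧
    -Real.log (1 - ε) / U ≤ maxDensity p ε ∧ maxDensity p ε ≤ -Real.log (1 - ε) / L := by
  have hlog : 0 < -Real.log (1 - ε) := neg_pos.2 (Real.log_neg (by linarith) (by linarith))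
  have hmem : ∀ l, l ∈ admissibleDensities p ε ↔ 0 < l ∧ 1 - ε ≤ s l := fun l => by
    simp only [admissibleDensities, Set.mem_ofPred_eq, hp, exists_prop]
  have hl0 : -Real.log (1 - ε) / U ∈ admissibleDensities p ε := by
    have hpos : 0 < -Real.log (1 - ε) / U := by positivity
    refine (hmem _).2 ⟨hpos, le_trans (le_of_eq ?_) (hsU _ hpos)⟩
    rw [div_mul_cancel₀ _ hU.ne', neg_neg, Real.exp_log (by linarith)]
  have hub : ∀ l ∈ admissibleDensities p ε, l ≤ -Real.log (1 - ε) / L := by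
    intro l hl
    obtain ⟨hl1, hl2⟩ := (hmem l).1 hl
    rw [le_div_iff₀ hL]
    have := Real.log_le_log (by linarith) (hl2.trans (hsL l hl1))
    rw [Real.log_exp] at this
    linarith
  have hbdd : BddAbove (admissibleDensities p ε) := ⟨_, hub⟩
  have hge : -Real.log (1 - ε) / U ≤ maxDensity p ε := le_csSup hbdd hl0
  have hpos : 0 < maxDensity p ε := lt_of_lt_of_le (by positivity) hge
  have hsM : 1 - ε ≤ s (maxDensity p ε) := by
    have hcl := closure_minimal (fun l hl => ((hmem l).1 hl).2)
      (isClosed_le continuous_const hs) (csSup_mem_closure ⟨_, hl0⟩ hbdd)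
    exact hcl
  have heq : s (maxDensity p ε) = 1 - ε := by
    refine le_antisymm (not_lt.1 fun hlt => ?_) hsM
    have hev : ∀ᶠ l in 𝓝[>] (maxDensity p ε), 1 - ε < s l :=
      (hs.continuousAt.eventually_const_lt hlt).filter_mono nhdsWithin_le_nhds
    obtain ⟨l, hl1, hl2⟩ := (hev.and self_mem_nhdsWithin).exists
    have hl2 : maxDensity p ε < l := hl2
    exact absurd (le_csSup hbdd ((hmem l).2 ⟨hpos.trans hl2, hl1.le⟩)) (not_le.2 hl2)
  refine ⟨⟨hpos, ⟨(hmem _).2 ⟨hpos, hsM⟩, fun l hl => le_csSup hbdd hl⟩, ?_⟩, hge,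
    csSup_le ⟨_, hl0⟩ hub⟩
  rw [hp]
  exact heq

end TwoWay

end

theorem theorem1 (q : TwoWay.Params) (hα : 2 < q.α) (hd : 0 < q.d)
    (hFTR : 0 < q.FTR) (hFRT : q.FTR < q.Ftotal) (hBTR : 0 < q.BTR) (hBRT : 0 < q.BRT)
    (ε : ℝ) (hε0 : 0 < ε) (hε1 : ε < 1)
    {Ω : Set.Ioi (0 : ℝ) → Type*} [∀ l, MeasurableSpace (Ω l)]
    (P : ∀ l, MeasureTheory.Measure (Ω l)) [∀ l, MeasureTheory.IsProbabilityMeasure (P l)]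
    (N : ∀ l : Set.Ioi (0 : ℝ), TwoWay.Network (P l) (l : ℝ))
    (p : Set.Ioi (0 : ℝ) → ℝ) (hp : ∀ l, p l = (N l).successProb q) :
    -- the maximal density is attained, with success probability exactly `1 - ε`
    (∃ hl : 0 < TwoWay.maxDensity p ε,
      IsGreatest (TwoWay.admissibleDensities p ε) (TwoWay.maxDensity p ε) ∧
      p ⟨TwoWay.maxDensity p ε, hl⟩ = 1 - ε) ∧
    -(1 - ε) * Real.log (1 - ε) / (q.c₁ * (q.β₁ ^ (2 / q.α) + q.β₂ ^ (2 / q.α)))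
        * ((q.BTR + q.BRT) / q.Ftotal) ≤ TwoWay.capacity q p ε ∧
    TwoWay.capacity q p ε ≤
      -(1 - ε) * Real.log (1 - ε) / (q.c₂ * (q.β₁ ^ (2 / q.α) + q.β₂ ^ (2 / q.α)))
        * ((q.BTR + q.BRT) / q.Ftotal) ∧
    q.c₂ / q.c₁ = 1 / 2 + 1 / q.α := by
  have hF : 0 < q.FRT := sub_pos.2 hFRT
  have hFtot : 0 < q.Ftotal := hFTR.trans hFRT
  have h₁ : 0 < q.β₁ := mul_pos (by positivity)
    (sub_pos.2 (Real.one_lt_rpow one_lt_two (by positivity)))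
  have h₂ : 0 < q.β₂ := mul_pos (by positivity)
    (sub_pos.2 (Real.one_lt_rpow one_lt_two (by positivity)))
  have hc₁ := TwoWay.Params.c₁_pos hα
  have hc₂ := TwoWay.Params.c₂_eq hα
  have hc₂pos : 0 < q.c₂ := by rw [hc₂]; positivity
  have hle := TwoWay.outageArea_le hα h₁ h₂
  have hge := TwoWay.le_outageArea hα h₁ h₂
  set b := q.β₁ ^ (2 / q.α) + q.β₂ ^ (2 / q.α)
  have hb : 0 < b := by positivity
  have hL : 0 < q.c₂ * b := by positivity
  have hU : 0 < q.c₁ * b := by positivity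
  obtain ⟨hmax, hlow, hupp⟩ := TwoWay.maxDensity_of_exp_bounds (p := p)
    (TwoWay.continuous_average_expNeg (TwoWay.measurable_outageArea q)
      fun θ => ((hle θ).trans_lt ENNReal.ofReal_lt_top).ne)
    (fun l => (hp l).trans ((N l).successProb_eq hd hFTR hFRT hBTR hBRT)) hL hU hε0 hε1
    (fun l hl => TwoWay.average_expNeg_le hL.le hl.le hge)
    (fun l hl => TwoWay.le_average_expNeg hU.le hl.le hle)
  have hB : 0 ≤ (q.BTR + q.BRT) / q.Ftotal := by positivity
  have hε : 0 ≤ 1 - ε := by linarith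
  refine ⟨hmax, ?_, ?_, ?_⟩
  · calc -(1 - ε) * Real.log (1 - ε) / (q.c₁ * b) * ((q.BTR + q.BRT) / q.Ftotal)
        = (1 - ε) * (-Real.log (1 - ε) / (q.c₁ * b)) * ((q.BTR + q.BRT) / q.Ftotal) := by ring
      _ ≤ TwoWay.capacity q p ε := by unfold TwoWay.capacity; gcongr
  · calc TwoWay.capacity q p ε
        ≤ (1 - ε) * (-Real.log (1 - ε) / (q.c₂ * b)) * ((q.BTR + q.BRT) / q.Ftotal) := by
          unfold TwoWay.capacity; gcongr
      _ = -(1 - ε) * Real.log (1 - ε) / (q.c₂ * b) * ((q.BTR + q.BRT) / q.Ftotal) := by ring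
  · rw [hc₂, mul_div_cancel_left₀ _ hc₁.ne']
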